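/- Setting. Consider the uplink of a network of $L$ cells; each cell has one base station with $N$ antennas and $K\le N$ single-antenna users, and all cells reuse the same $K$ orthogonal pilot sequences of length $\tau\ge K$. Fix a base station $l$ and one of its users $k$. Let $\beta_{lij}>0$ be the large-scale fading coefficient from user $j$ of cell $i$ to base station $l$, let $\alpha\in[-1,1]$ be the temporal correlation coefficient of the channel, and assume that $L\ge 2$ or $|\alpha|<1$. For uplink power $p_r>0$ and training power $p_{\mathrm{tr}}=\tau p_r$ put $$\hat\beta_{lij}=\frac{\beta_{lij}^2}{\sum_{m=1}^L\beta_{lmj}+1/p_{\mathrm{tr}}},\qquad C=\sum_{i\ne l}\Big(\frac{\beta_{lik}}{\beta_{llk}}\Big)^2 .$$ The $N\times K$ matrices $\hat G_{li}$ of delayed channel estimates and $\tilde E_{li}$ of combined estimation and channel-aging errors ($i=1,\dots,L$) are modelled as follows: the columns $\hat g_{llj}\sim\mathcal{CN}(0,\hat\beta_{llj}I_N)$ of $\hat G_{ll}$ and the columns $\tilde e_{lij}\sim\mathcal{CN}(0,(\beta_{lij}-\alpha^2\hat\beta_{lij})I_N)$ of $\tilde E_{l1},\dots,\tilde E_{lL}$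 are all mutually independent, and $\hat G_{li}=\hat G_{ll}\,\mathrm{diag}(\beta_{li1}/\beta_{ll1},\dots,\beta_{liK}/\beta_{llK})$. With $\hat G_{ll}^\dagger$ the Moore--Penrose pseudo-inverse and $[\cdot]_k$ the $k$th row, the SINR of user $k$ after zero-forcing is $$\gamma_k=\frac{\alpha^2p_r}{\alpha^2p_r\sum_{i\ne l}\big\|[\hat G_{ll}^\dagger]_k\hat G_{li}\big\|^2+p_r\sum_{i=1}^L\big\|[\hat G_{ll}^\dagger]_k\tilde E_{li}\big\|^2+\big\|[\hat G_{ll}^\dagger]_k\big\|^2}.$$ Let $X$ and $Y$ be independent real random variables with the following densities, where $\hat\beta^\infty_{lij}=\beta_{lij}^2/\sum_{m}\beta_{lmj}$ denotes the limit of $\hat\beta_{lij}$ as $p_r\to\infty$. The density of $X$ is $$f_X(x)=\frac{e^{-x/\hat\beta^\infty_{llk}}}{(N-K)!\,\hat\beta^\infty_{llk}}\Big(\frac{x}{\hat\beta^\infty_{llk}}\Big)^{N-K},\quad x\ge0 .$$ The density of $Y$ is $$f_Y(y)=\sum_{\mu}\sum_{q=1}^{t(\mu)}\chi_{\mu,q}\frac{\mu^{-q}}{(q-1)!}\,y^{q-1}e^{-y/\mu},\quad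 y\ge0,$$ where $\mu$ runs over the distinct values among the $KL$ numbers $\beta_{lij}-\alpha^2\hat\beta^\infty_{lij}$ ($1\le i\le L$, $1\le j\le K$), $t(\mu)$ is the multiplicity of $\mu$ among them, and the $\chi_{\mu,q}$ are the coefficients of the partial fraction expansion $\prod_{i,j}\big(1+\xi(\beta_{lij}-\alpha^2\hat\beta^\infty_{lij})\big)^{-1}=\sum_\mu\sum_{q=1}^{t(\mu)}\chi_{\mu,q}(1+\xi\mu)^{-q}$. Claim (high uplink power). As $p_r\to\infty$, $$\gamma_k\ \xrightarrow{\ d\ }\ \frac{\alpha^2X}{\alpha^2CX+Y}.$$ The SINR has a finite ceiling: the denominator $\alpha^2CX+Y$ of the limit is almost surely positive, so that the limit is almost surely finite, and $\gamma_k$ stays bounded in probability: for every $\varepsilon>0$ there is a finite $M$ such that $\Pr(\gamma_k>M)\le\varepsilon$ for every $p_r>0$. -/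

import Mathlib

open MeasureTheory ProbabilityTheory Filter Topology

noncomputable section

namespace UplinkZF

/-! ### Moore-Penrose pseudo-inverse -/

/-- `B` satisfies the four Penrose equations for `A`. -/
structure IsPseudoinverse {m n : ℕ} (A : Matrix (Fin m) (Fin n) ℂ)
    (B : Matrix (Fin n) (Fin m) ℂ) : Prop where
  mul_mul_self : A * B * A = A
  self_mul_mul : B * A * B = B
  left_herm : (A * B).IsHermitian
  right_herm : (B * A).IsHermitian

open scoped ComplexOrder in
/-- Every complex matrix has a pseudo-inverse. -/
theorem exists_isPseudoinverse {m n : ℕ} (A : Matrix (Fin m) (Fin n) ℂ) :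
    ∃ B, IsPseudoinverse A B := by
  have hH : (A.conjTranspose * A).IsHermitian := Matrix.isHermitian_conjTranspose_mul_self A
  set H := A.conjTranspose * A with hHdef
  set U : Matrix (Fin n) (Fin n) ℂ := (hH.eigenvectorUnitary : Matrix (Fin n) (Fin n) ℂ) with hU
  set d : Fin n → ℂ := fun i => (hH.eigenvalues i : ℂ) with hd
  have hUU : U.conjTranspose * U = 1 := by
    have h := Unitary.coe_star_mul_self hH.eigenvectorUnitary
    simpa [hU, Matrix.star_eq_conjTranspose] using h
  have hspec : H = U * Matrix.diagonal d * U.conjTranspose := by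
    have h := hH.spectral_theorem
    rw [Unitary.conjStarAlgAut_apply] at h
    exact h
  have key : ∀ a b : Fin n → ℂ, (U * Matrix.diagonal a * U.conjTranspose) *
      (U * Matrix.diagonal b * U.conjTranspose) =
      U * Matrix.diagonal (fun i => a i * b i) * U.conjTranspose := by
    intro a b
    calc _ = U * Matrix.diagonal a * (U.conjTranspose * U) * Matrix.diagonal b
            * U.conjTranspose := by simp only [Matrix.mul_assoc]
      _ = _ := by
        rw [hUU, Matrix.mul_one, Matrix.mul_assoc U, Matrix.diagonal_mul_diagonal]
  have herm : ∀ a : Fin n → ℂ, (∀ i, star (a i) = a i) →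
      (U * Matrix.diagonal a * U.conjTranspose).IsHermitian := by
    intro a ha
    have : star a = a := funext ha
    simp [Matrix.IsHermitian, Matrix.conjTranspose_mul, Matrix.mul_assoc,
      Matrix.diagonal_conjTranspose, this]
  set P := U * Matrix.diagonal (fun i => (d i)⁻¹) * U.conjTranspose with hP
  set Q := U * Matrix.diagonal (fun i => (d i)⁻¹ * d i) * U.conjTranspose with hQ
  have hPH : P * H = Q := by rw [hspec, hP, key]
  have hQherm : Q.IsHermitian := herm _ fun i => by simp [hd]
  have hPherm : P.IsHermitian := herm _ fun i => by simp [hd]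
  have hHQ : H * Q = H := by
    rw [hspec, hQ, key]
    congr 3
    funext i
    by_cases h : d i = 0
    · simp [h]
    · field_simp
  have hQP : Q * P = P := by
    rw [hP, hQ, key]
    congr 3
    funext i
    by_cases h : d i = 0
    · simp [h]
    · field_simp
  have hAQ : A * Q = A := by
    have h0 : (A * Q - A).conjTranspose * (A * Q - A) = 0 := by
      have h1 : (A * Q - A) = A * (Q - 1) := by rw [Matrix.mul_sub, Matrix.mul_one]
      rw [h1, Matrix.conjTranspose_mul, Matrix.mul_assoc, ← Matrix.mul_assoc _ A, ← hHdef,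
        Matrix.mul_sub, hHQ, Matrix.mul_one, sub_self, Matrix.mul_zero]
    exact sub_eq_zero.1 (Matrix.conjTranspose_mul_self_eq_zero.1 h0)
  have hBA : P * A.conjTranspose * A = Q := by rw [Matrix.mul_assoc, ← hHdef, hPH]
  refine ⟨P * A.conjTranspose, ?_, ?_, ?_, ?_⟩
  · rw [Matrix.mul_assoc, hBA, hAQ]
  · rw [hBA, ← Matrix.mul_assoc, hQP]
  · have : (A * (P * A.conjTranspose)).conjTranspose = A * (P * A.conjTranspose) := by
      rw [Matrix.conjTranspose_mul, Matrix.conjTranspose_mul, Matrix.conjTranspose_conjTranspose,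
        hPherm.eq, Matrix.mul_assoc]
    exact this
  · rw [hBA]; exact hQherm

/-- The pseudo-inverse is unique. -/
theorem IsPseudoinverse.unique {m n : ℕ} {A : Matrix (Fin m) (Fin n) ℂ}
    {B C : Matrix (Fin n) (Fin m) ℂ} (hB : IsPseudoinverse A B) (hC : IsPseudoinverse A C) :
    B = C := by
  have h1 : A * B = A * C := by
    calc A * B = (A * C) * (A * B) := by
          rw [← Matrix.mul_assoc, hC.mul_mul_self]
      _ = ((A * B) * (A * C)).conjTranspose := by
          rw [Matrix.conjTranspose_mul, hB.left_herm.eq, hC.left_herm.eq]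
      _ = A * C := by
          rw [← Matrix.mul_assoc, hB.mul_mul_self, hC.left_herm.eq]
  have h2 : B * A = C * A := by
    calc B * A = (B * A) * (C * A) := by
          rw [Matrix.mul_assoc, ← Matrix.mul_assoc A, hC.mul_mul_self]
      _ = ((C * A) * (B * A)).conjTranspose := by
          rw [Matrix.conjTranspose_mul, hB.right_herm.eq, hC.right_herm.eq]
      _ = C * A := by
          rw [Matrix.mul_assoc, ← Matrix.mul_assoc A, hB.mul_mul_self, hC.right_herm.eq]
  calc B = B * A * B := hB.self_mul_mul.symm
    _ = C * A * C := by rw [h2, Matrix.mul_assoc, h1, ← Matrix.mul_assoc]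
    _ = C := hC.self_mul_mul

/-- The Moore-Penrose pseudo-inverse of a complex matrix. -/
def pinv {m n : ℕ} (A : Matrix (Fin m) (Fin n) ℂ) : Matrix (Fin n) (Fin m) ℂ :=
  (exists_isPseudoinverse A).choose

/-! ### Complex Gaussian laws -/

/-- The circularly symmetric law `CN(0, v)` on `ℂ`: independent real and imaginary parts, each
with law `N(0, v/2)`. -/
def complexGaussian (v : ℝ) : Measure ℂ :=
  ((gaussianReal 0 (v / 2).toNNReal).prod (gaussianReal 0 (v / 2).toNNReal)).map
    (fun z : ℝ × ℝ => (⟨z.1, z.2⟩ : ℂ))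

/-- The law `CN(0, v I_N)` on `ℂ^N`. -/
def complexGaussianVec (N : ℕ) (v : ℝ) : Measure (Fin N → ℂ) :=
  Measure.pi fun _ => complexGaussian v

/-! ### The system model, seen from a fixed base station `l` -/

section Model

variable {L N K : ℕ}

/-- Variance `β̂_{lik} = β_{lik}² / (∑_j β_{ljk} + ν)` of the MMSE channel estimate, where
`ν = 1/p_tr` is the inverse training power (`ν = 0` is the limit `p_tr → ∞`). -/
def betaHat (β : Fin L → Fin L → Fin K → ℝ) (ν : ℝ) (l i : Fin L) (k : Fin K) : ℝ :=
  β l i k ^ 2 / ((∑ j, β l j k) + ν)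

/-- Variance `β_{lik} - α² β̂_{lik}` of the combined estimation and channel-aging error. These are
the `K L` diagonal elements of the matrix `𝒜`. -/
def errVar (β : Fin L → Fin L → Fin K → ℝ) (α ν : ℝ) (l i : Fin L) (k : Fin K) : ℝ :=
  β l i k - α ^ 2 * betaHat β ν l i k

/-- The constant `C = ∑_{i ≠ l} (β_{lik} / β_{llk})²`. -/
def interfConst (β : Fin L → Fin L → Fin K → ℝ) (l : Fin L) (k : Fin K) : ℝ :=
  ∑ i ∈ Finset.univ.erase l, (β l i k / β l l k) ^ 2

/-- The joint law of the delayed channel estimates `Ghat i = Ĝ_{li}[n-1]` and of the combined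
errors `Etil i = Ẽ_{li}[n]` at base station `l`, for inverse training power `ν`: the columns of
`Ĝ_{ll}` and of all the `Ẽ_{li}` are mutually independent complex Gaussian vectors, and, since all
the cells use the same pilots, `Ĝ_{li} = Ĝ_{ll} D_i` with `D_i = diag(β_{lik} / β_{llk})_k`. -/
structure IsChannelModel (β : Fin L → Fin L → Fin K → ℝ) (α ν : ℝ) (l : Fin L)
    {Ω : Type*} [MeasurableSpace Ω] (P : Measure Ω)
    (Ghat Etil : Fin L → Ω → Matrix (Fin N) (Fin K) ℂ) : Prop where
  estimate_law : ∀ k : Fin K, HasLaw (fun ω => (Ghat l ω).col k)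
    (complexGaussianVec N (betaHat β ν l l k)) P
  error_law : ∀ (i : Fin L) (k : Fin K), HasLaw (fun ω => (Etil i ω).col k)
    (complexGaussianVec N (errVar β α ν l i k)) P
  indep : iIndepFun (Sum.elim (fun (k : Fin K) (ω : Ω) => (Ghat l ω).col k)
    (fun (ik : Fin L × Fin K) (ω : Ω) => (Etil ik.1 ω).col ik.2)) P
  pilot_reuse : ∀ (i : Fin L) (ω : Ω),
    Ghat i ω = Ghat l ω * Matrix.diagonal fun k => ((β l i k / β l l k : ℝ) : ℂ)

/-- Squared Euclidean norm of the `k`th row of a matrix. -/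
def rowNormSq {m n : ℕ} (A : Matrix (Fin m) (Fin n) ℂ) (k : Fin m) : ℝ := ∑ j, ‖A k j‖ ^ 2

/-- The SINR after zero-forcing of the `k`th user in the `l`th cell, at uplink power `p`. Row `k`
of `Ĝ_{ll}† M` is the product of the `k`th row of `Ĝ_{ll}†` with `M`. -/
def sinr (α p : ℝ) (l : Fin L) (k : Fin K) (Ghat Etil : Fin L → Matrix (Fin N) (Fin K) ℂ) : ℝ :=
  α ^ 2 * p /
    (α ^ 2 * p * (∑ i ∈ Finset.univ.erase l, rowNormSq (pinv (Ghat l) * Ghat i) k)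
      + p * (∑ i, rowNormSq (pinv (Ghat l) * Etil i) k)
      + rowNormSq (pinv (Ghat l)) k)

end Model

/-! ### The densities -/

/-- Density of the Erlang law with scale `b` and shape `N - K + 1` (used for `K ≤ N`). -/
def pdfX (N K : ℕ) (b x : ℝ) : ℝ :=
  if 0 ≤ x then Real.exp (-x / b) / ((N - K).factorial * b) * (x / b) ^ (N - K) else 0

section CharCoeff

variable {ι : Type*} [Fintype ι]

/-- The distinct values of the family `a`. -/
def distinctVals (a : ι → ℝ) : Finset ℝ := Finset.univ.image a

/-- The multiplicity of `μ` in the family `a`. -/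
def mult (a : ι → ℝ) (μ : ℝ) : ℕ := (Finset.univ.filter fun i => a i = μ).card

/-- `χ` gives the characteristic coefficients of the diagonal matrix `A` with diagonal `a`: the
partial fraction expansion `det(I + ξ A)⁻¹ = ∑_μ ∑_{q = 1}^{mult μ} χ_{μ,q} / (1 + ξ μ)^q`, over
the distinct diagonal elements `μ`. -/
def IsCharCoeff (a : ι → ℝ) (χ : ℝ → ℕ → ℝ) : Prop :=
  ∀ ξ : ℝ, 0 ≤ ξ → (∏ i, (1 + ξ * a i))⁻¹ =
    ∑ μ ∈ distinctVals a, ∑ q ∈ Finset.Icc 1 (mult a μ), χ μ q / (1 + ξ * μ) ^ q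

/-- The partial fraction expansion exists for positive diagonal elements. -/
theorem exists_isCharCoeff [Nonempty ι] (a : ι → ℝ) (ha : ∀ i, 0 < a i) :
    ∃ χ, IsCharCoeff a χ := by
  classical
  set s := distinctVals a with hs
  set n := mult a with hn
  have hpos : ∀ μ ∈ s, 0 < μ := by
    intro μ hμ
    simp only [hs, distinctVals, Finset.mem_image, Finset.mem_univ, true_and] at hμ
    obtain ⟨i, rfl⟩ := hμ
    exact ha i
  have hnpos : ∀ μ ∈ s, 0 < n μ := by
    intro μ hμ
    simp only [hs, distinctVals, Finset.mem_image, Finset.mem_univ, true_and] at hμ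
    obtain ⟨i, hi⟩ := hμ
    exact Finset.card_pos.2 ⟨i, by simp [hi]⟩
  have hsne : s.Nonempty := Finset.univ_nonempty.image a
  let g : ℝ → Polynomial ℝ := fun μ => Polynomial.X + Polynomial.C μ⁻¹
  have hgm : ∀ μ, (g μ).Monic := fun μ => Polynomial.monic_X_add_C _
  have hgd : ∀ μ, (g μ).degree = 1 := fun μ => Polynomial.degree_X_add_C _
  have hcop : Set.Pairwise (s : Set ℝ) fun i j => IsCoprime (g i) (g j) := by
    intro i hi j hj hij
    have h := Polynomial.pairwise_coprime_X_sub_C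
      (s := fun μ : ℝ => -μ⁻¹) (fun x y h => by simpa using h) hij
    simpa [g, Function.onFun] using h
  obtain ⟨q, r, hr, hone⟩ := Polynomial.eq_quo_mul_prod_pow_add_sum_rem_mul_prod_pow
    (1 : Polynomial ℝ) (fun μ _ => hgm μ) hcop n
  set R := ∏ μ ∈ s, g μ ^ n μ with hR
  have hRm : R.Monic := Polynomial.monic_prod_of_monic _ _ fun μ _ => (hgm μ).pow _
  have hsplit : ∀ μ ∈ s, R = g μ ^ n μ * ∏ k ∈ s.erase μ, g k ^ n k :=
    fun μ hμ => (Finset.mul_prod_erase s _ hμ).symm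
  have hRdeg : ∀ μ ∈ s, ∀ j : Fin (n μ),
      (r μ j * g μ ^ j.1 * ∏ k ∈ s.erase μ, g k ^ n k).degree < R.degree := by
    intro μ hμ j
    have hm : (∏ k ∈ s.erase μ, g k ^ n k).Monic :=
      Polynomial.monic_prod_of_monic _ _ fun μ _ => (hgm μ).pow _
    by_cases h0 : r μ j = 0
    · rw [h0, zero_mul, zero_mul, Polynomial.degree_zero, bot_lt_iff_ne_bot, Ne,
        Polynomial.degree_eq_bot]
      exact hRm.ne_zero
    have hr0 : (r μ j).degree = 0 := by
      have h1 := hr μ hμ j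
      rw [hgd] at h1
      exact Polynomial.degree_eq_zero_of_isUnit (Polynomial.isUnit_iff_degree_eq_zero.2
        (le_antisymm (Polynomial.natDegree_eq_zero_iff_degree_le_zero.1
          (by rw [Polynomial.degree_eq_natDegree h0] at h1
              have : (r μ j).natDegree < 1 := by exact_mod_cast h1
              omega)) (Polynomial.zero_le_degree_iff.2 h0)))
    rw [hsplit μ hμ, Polynomial.degree_mul, Polynomial.degree_mul, Polynomial.degree_mul, hr0,
      Polynomial.degree_pow, Polynomial.degree_pow, hgd, zero_add,
      Polynomial.degree_eq_natDegree hm.ne_zero]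
    simp only [nsmul_eq_mul, mul_one]
    have := j.2
    norm_cast
    omega
  have hq : q = 0 := by
    by_contra hq0
    have hRpos : (1 : Polynomial ℝ).degree < R.degree := by
      obtain ⟨μ, hμ⟩ := hsne
      have hm : (∏ k ∈ s.erase μ, g k ^ n k).Monic :=
        Polynomial.monic_prod_of_monic _ _ fun μ _ => (hgm μ).pow _
      rw [hsplit μ hμ, Polynomial.degree_mul, Polynomial.degree_pow, hgd, Polynomial.degree_one,
        Polynomial.degree_eq_natDegree hm.ne_zero]
      have := hnpos μ hμ
      simp only [nsmul_eq_mul, mul_one]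
      norm_cast
      omega
    set T := ∑ μ ∈ s, ∑ j, r μ j * g μ ^ j.1 * ∏ k ∈ s.erase μ, g k ^ n k with hT
    have hbot : (⊥ : WithBot ℕ) < R.degree := bot_le.trans_lt hRpos
    have hTdeg : T.degree < R.degree := by
      refine (Polynomial.degree_sum_le _ _).trans_lt ((Finset.sup_lt_iff hbot).2 fun μ hμ => ?_)
      exact (Polynomial.degree_sum_le _ _).trans_lt
        ((Finset.sup_lt_iff hbot).2 fun j _ => hRdeg μ hμ j)
    have h1 : q * R = 1 - T := eq_sub_of_add_eq hone.symm
    have h2 : (q * R).degree < R.degree := by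
      rw [h1]
      exact (Polynomial.degree_sub_le _ _).trans_lt (max_lt hRpos hTdeg)
    rw [Polynomial.degree_mul, Polynomial.degree_eq_natDegree hq0,
      Polynomial.degree_eq_natDegree hRm.ne_zero] at h2
    norm_cast at h2
    omega
  rw [hq, zero_mul, zero_add] at hone
  refine ⟨fun μ m => if h : n μ - m < n μ then
    (∏ κ ∈ s, κ ^ n κ)⁻¹ * (r μ ⟨n μ - m, h⟩).coeff 0 * μ ^ m else 0, ?_⟩
  intro ξ hξ
  rw [← hs, ← hn]
  have hf : ∀ μ ∈ s, 0 < 1 + ξ * μ := fun μ hμ => by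
    have := hpos μ hμ
    positivity
  have hge : ∀ μ ∈ s, (g μ).eval ξ = (1 + ξ * μ) / μ := fun μ hμ => by
    have := (hpos μ hμ).ne'
    simp only [g, Polynomial.eval_add, Polynomial.eval_X, Polynomial.eval_C]
    field_simp
    ring
  have hgpos : ∀ μ ∈ s, 0 < (g μ).eval ξ := fun μ hμ => by
    rw [hge μ hμ]
    exact div_pos (hf μ hμ) (hpos μ hμ)
  have hprod : ∏ i, (1 + ξ * a i) = ∏ μ ∈ s, (1 + ξ * μ) ^ n μ :=
    Finset.prod_comp (fun μ => 1 + ξ * μ) a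
  have hReval : R.eval ξ = (∏ μ ∈ s, (1 + ξ * μ) ^ n μ) * (∏ μ ∈ s, μ ^ n μ)⁻¹ := by
    rw [hR, Polynomial.eval_prod, ← Finset.prod_inv_distrib, ← Finset.prod_mul_distrib]
    refine Finset.prod_congr rfl fun μ hμ => ?_
    rw [Polynomial.eval_pow, hge μ hμ, div_pow, div_eq_mul_inv]
  have hPpos : 0 < ∏ μ ∈ s, μ ^ n μ := Finset.prod_pos fun μ hμ => pow_pos (hpos μ hμ) _
  have hRpos : 0 < R.eval ξ := by
    rw [hR, Polynomial.eval_prod]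
    exact Finset.prod_pos fun μ hμ => by
      rw [Polynomial.eval_pow]
      exact pow_pos (hgpos μ hμ) _
  have hev := congrArg (Polynomial.eval ξ) hone
  rw [Polynomial.eval_one, Polynomial.eval_finsetSum] at hev
  have hinv : (∏ i, (1 + ξ * a i))⁻¹ = (∏ μ ∈ s, μ ^ n μ)⁻¹ * (R.eval ξ)⁻¹ := by
    rw [hprod, hReval, mul_inv, inv_inv]
    field_simp
  have hRi : (R.eval ξ)⁻¹ = (∑ μ ∈ s, Polynomial.eval ξ
      (∑ j, r μ j * g μ ^ j.1 * ∏ k ∈ s.erase μ, g k ^ n k)) * (R.eval ξ)⁻¹ := by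
    rw [← hev, one_mul]
  rw [hinv, hRi, Finset.sum_mul, Finset.mul_sum]
  refine Finset.sum_congr rfl fun μ hμ => ?_
  rw [Polynomial.eval_finsetSum, Finset.sum_mul, Finset.mul_sum]
  refine Finset.sum_bij' (fun j _ => n μ - j.1)
    (fun m hm => ⟨n μ - m, by rw [Finset.mem_Icc] at hm; omega⟩) ?_ ?_ ?_ ?_ ?_
  · intro j _
    have := j.2
    rw [Finset.mem_Icc]
    omega
  · intro m _
    exact Finset.mem_univ _
  · intro j _
    have := j.2
    ext
    simp only
    omega
  · intro m hm
    rw [Finset.mem_Icc] at hm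
    simp only
    omega
  · intro j _
    have hj := j.2
    have hjj : n μ - (n μ - j.1) = j.1 := by omega
    have hlt : n μ - (n μ - j.1) < n μ := by omega
    have hfin : (⟨n μ - (n μ - j.1), hlt⟩ : Fin (n μ)) = j := Fin.ext hjj
    have hrc : (r μ j).eval ξ = (r μ j).coeff 0 := by
      have h1 := hr μ hμ j
      rw [hgd] at h1
      have h2 : (r μ j).degree ≤ 0 := Polynomial.natDegree_eq_zero_iff_degree_le_zero.1 (by
        by_cases h0 : r μ j = 0
        · simp [h0]
        · rw [Polynomial.degree_eq_natDegree h0] at h1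
          have : (r μ j).natDegree < 1 := by exact_mod_cast h1
          omega)
      rw [Polynomial.eq_C_of_degree_le_zero h2]
      simp
    simp only [dif_pos hlt, hfin]
    have hμ0 := hpos μ hμ
    have hf0 := hf μ hμ
    have hE : 0 < (∏ k ∈ s.erase μ, g k ^ n k).eval ξ := by
      rw [Polynomial.eval_prod]
      exact Finset.prod_pos fun κ hκ => by
        rw [Polynomial.eval_pow]
        exact pow_pos (hgpos κ (Finset.mem_of_mem_erase hκ)) _
    have hgp := hgpos μ hμ
    rw [hsplit μ hμ, Polynomial.eval_mul, Polynomial.eval_mul, Polynomial.eval_mul,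
      Polynomial.eval_pow, Polynomial.eval_pow, hrc]
    have hpw : (g μ).eval ξ ^ n μ = (g μ).eval ξ ^ j.1 * (g μ).eval ξ ^ (n μ - j.1) := by
      rw [← pow_add]
      congr 1
      omega
    have hq2 : μ ^ (n μ - j.1) / (1 + ξ * μ) ^ (n μ - j.1)
        = ((g μ).eval ξ ^ (n μ - j.1))⁻¹ := by
      rw [hge μ hμ, div_pow, inv_div]
    rw [mul_div_assoc, hq2, hpw]
    field_simp

/-- The characteristic coefficients of the diagonal matrix with (positive) diagonal `a`. -/
def charCoeff (a : ι → ℝ) : ℝ → ℕ → ℝ := Classical.epsilon (IsCharCoeff a)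

/-- The density `∑_μ ∑_q χ_{μ,q} μ^{-q} / (q-1)! y^{q-1} e^{-y/μ}` on `y ≥ 0`. -/
def pdfY (a : ι → ℝ) (y : ℝ) : ℝ :=
  if 0 ≤ y then
    ∑ μ ∈ distinctVals a, ∑ q ∈ Finset.Icc 1 (mult a μ),
      charCoeff a μ q * ((μ ^ q)⁻¹ / (q - 1).factorial) * y ^ (q - 1) * Real.exp (-y / μ)
  else 0

end CharCoeff

end UplinkZF

end

/-! Write $A=\hat G_{ll}$, let $r$ be row $k$ of $A^\dagger$ and $\rho=\|r\|^2$. The columns of $A$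
are almost surely independent, so $A^\dagger A=1$. By pilot reuse the interference row is then a row
of a diagonal matrix, and the interference sum is the constant $C$. Dividing numerator and
denominator by $p\rho$ gives $\gamma_k=\alpha^2X_p/(\alpha^2CX_p+Y_p+1/p)$ with $X_p=1/\rho$ and
$Y_p=\rho^{-1}\sum|r\cdot\tilde e_{lij}|^2$ (`sinr_eq_sinrFun`).

Two invariances of the complex Gaussian law give the joint law of $(X_p,Y_p)$. First, $X_p$ is the
squared distance of column $k$ of $A$ to the span of the other $K-1$ columns. Given those, it is the
squared norm of a Gaussian vector in $N-K+1$ dimensions (`map_inv_rowNormSq_leftInv`). Second, given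
$A$, the vector $r/\|r\|$ is a fixed unit vector, so the conditional law of $Y_p$ is that of a
weighted sum of independent $|w_{ij}|^2$ and does not depend on $A$. Hence $Y_p$ is independent of
$X_p$ (`map_zfPair`).

All the SINRs can therefore be realised on one space of standard Gaussian variables, where $p$
enters only through the variances and the term $1/p$. There they converge almost surely, which
yields convergence in distribution. The variance of the estimate increases to its limit and the
error variances decrease to theirs, so for every $p$ the SINR is dominated by the single finite
variable $\alpha^2X/Y$. This is the ceiling.

It remains to match the limit variables with the stated densities. Both sides have the same Laplace
transform at the integers, a product of factors $(1+\xi a_i)^{-1}$ that for $Y$ is expanded in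
partial fractions, and this determines a finite measure on the half-line (`ext_of_laplace`,
`withDensity_eq_of_laplace`). -/

noncomputable section

namespace UplinkZF

/-! ### Uniqueness of Laplace transforms -/

/-- The function `x ↦ exp (-x)` on `[0, ∞)`. -/
def expNeg : BoundedContinuousFunction NNReal ℝ :=
  BoundedContinuousFunction.ofNormedAddCommGroup (fun x : NNReal => Real.exp (-(x : ℝ)))
    (by fun_prop) 1 (fun x => by
      rw [Real.norm_eq_abs, abs_of_pos (Real.exp_pos _), Real.exp_le_one_iff]
      simp)

theorem expNeg_apply (x : NNReal) : expNeg x = Real.exp (-(x : ℝ)) := rfl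

/-- A finite measure on `[0, ∞)` is determined by its Laplace transform at the integers. -/
theorem ext_of_laplace_nnreal {μ ν : Measure NNReal} [IsFiniteMeasure μ] [IsFiniteMeasure ν]
    (h : ∀ n : ℕ, ∫ x : NNReal, Real.exp (-(n * (x : ℝ))) ∂μ
      = ∫ x : NNReal, Real.exp (-(n * (x : ℝ))) ∂ν) : μ = ν := by
  -- Polynomials in $e^{-x}$ form a subalgebra that separates points, and their integrals are linear
  -- combinations of the Laplace transform at integers. The value $n=0$ covers the constants.
  let A : StarSubalgebra ℝ (BoundedContinuousFunction NNReal ℝ) :=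
    { (Polynomial.aeval (R := ℝ) expNeg).range with
      star_mem' := fun {a} ha => by
        obtain ⟨p, rfl⟩ := ha
        exact ⟨p, by ext; simp⟩ }
  have hpow : ∀ (n : ℕ) (x : NNReal), (expNeg ^ n) x = Real.exp (-(n * (x : ℝ))) := by
    intro n x
    rw [BoundedContinuousFunction.pow_apply, expNeg_apply, ← Real.exp_nat_mul]
    ring_nf
  refine ext_of_forall_mem_subalgebra_integral_eq_of_pseudoEMetric_complete_countable
    (𝕜 := ℝ) (A := A) ?_ ?_
  · intro x y hxy
    refine ⟨expNeg, ⟨BoundedContinuousFunction.toContinuousMapStarₐ ℝ expNeg, ?_, rfl⟩, ?_⟩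
    · exact ⟨expNeg, ⟨Polynomial.X, by simp⟩, rfl⟩
    · rw [expNeg_apply, expNeg_apply]
      intro h
      exact hxy (NNReal.coe_injective (neg_injective (Real.exp_injective h)))
  · rintro g ⟨p, rfl⟩
    have key : ∀ (m : Measure NNReal) [IsFiniteMeasure m],
        ∫ x, (Polynomial.aeval expNeg p : BoundedContinuousFunction NNReal ℝ) x ∂m
          = ∑ n ∈ p.support, p.coeff n * ∫ x : NNReal, Real.exp (-(n * (x : ℝ))) ∂m := by
      intro m _
      have : ∀ x, (Polynomial.aeval expNeg p : BoundedContinuousFunction NNReal ℝ) x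
          = ∑ n ∈ p.support, p.coeff n * Real.exp (-(n * (x : ℝ))) := by
        intro x
        rw [Polynomial.aeval_eq_sum_range' (n := p.natDegree + 1) (by omega)]
        rw [BoundedContinuousFunction.sum_apply]
        simp only [BoundedContinuousFunction.smul_apply, hpow, smul_eq_mul]
        refine (Finset.sum_subset (fun n hn => ?_) fun n _ hn => ?_).symm
        · exact Finset.mem_range_succ_iff.2 (Polynomial.le_natDegree_of_mem_supp n hn)
        · rw [Polynomial.notMem_support_iff.1 hn, zero_mul]
      simp_rw [this]
      rw [integral_finsetSum]
      · simp_rw [integral_const_mul]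
      · intro n _
        refine Integrable.const_mul ?_ _
        have := (expNeg ^ n).integrable m
        exact this.congr (ae_of_all _ fun x => hpow n x)
    have e1 := key μ
    have e2 := key ν
    simp only [h] at e1
    exact e1.trans e2.symm

/-- A finite measure on `ℝ` concentrated on `[0, ∞)` is determined by its Laplace transform at the
integers. -/
theorem ext_of_laplace {μ ν : Measure ℝ} [IsFiniteMeasure μ] [IsFiniteMeasure ν]
    (hμ : ∀ᵐ x ∂μ, 0 ≤ x) (hν : ∀ᵐ x ∂ν, 0 ≤ x)
    (h : ∀ n : ℕ, ∫ x, Real.exp (-(n * x)) ∂μ = ∫ x, Real.exp (-(n * x)) ∂ν) : μ = ν := by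
  have back : ∀ m : Measure ℝ, (∀ᵐ x ∂m, 0 ≤ x) →
      (m.map Real.toNNReal).map ((↑) : NNReal → ℝ) = m := by
    intro m hm
    rw [Measure.map_map measurable_coe_nnreal_real measurable_real_toNNReal]
    have : ((↑) : NNReal → ℝ) ∘ Real.toNNReal =ᵐ[m] id := by
      filter_upwards [hm] with x hx
      simp [hx]
    rw [Measure.map_congr this, Measure.map_id]
  have tr : ∀ m : Measure ℝ, (∀ᵐ x ∂m, 0 ≤ x) → ∀ n : ℕ,
      ∫ x : NNReal, Real.exp (-(n * (x : ℝ))) ∂(m.map Real.toNNReal)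
        = ∫ x, Real.exp (-(n * x)) ∂m := by
    intro m hm n
    rw [integral_map measurable_real_toNNReal.aemeasurable
      (Continuous.aestronglyMeasurable (by fun_prop))]
    refine integral_congr_ae ?_
    filter_upwards [hm] with x hx
    simp [hx]
  rw [← back μ hμ, ← back ν hν]
  congr 1
  refine ext_of_laplace_nnreal fun n => ?_
  rw [tr μ hμ, tr ν hν, h n]

/-- If `f (a, ·)` has the same law `m` for almost every `a`, then `f` is independent of the first
coordinate. -/
theorem map_prod_of_ae_map_eq {A B C D : Type*} [MeasurableSpace A] [MeasurableSpace B]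
    [MeasurableSpace C] [MeasurableSpace D] {μ : Measure A} {ν : Measure B} {m : Measure D}
    [IsProbabilityMeasure μ] [IsProbabilityMeasure ν] [IsProbabilityMeasure m]
    {h : A → C} {f : A × B → D} (hh : Measurable h) (hf : Measurable f)
    (hm : ∀ᵐ a ∂μ, ν.map (fun b => f (a, b)) = m) :
    (μ.prod ν).map (fun z => (h z.1, f z)) = (μ.map h).prod m := by
  have := Measure.isProbabilityMeasure_map (μ := μ) hh.aemeasurable
  refine (Measure.prod_eq fun s t hs ht => ?_).symm
  have hmeas : Measurable fun z : A × B => (h z.1, f z) := (hh.comp measurable_fst).prodMk hf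
  rw [Measure.map_apply hmeas (hs.prod ht), Measure.prod_apply (hmeas (hs.prod ht)),
    Measure.map_apply hh hs, ← setLIntegral_one, ← lintegral_indicator (hh hs),
    ← lintegral_mul_const' _ _ (measure_ne_top m t)]
  refine lintegral_congr_ae ?_
  filter_upwards [hm] with a ha
  by_cases hs' : a ∈ h ⁻¹' s
  · rw [Set.indicator_of_mem hs', one_mul, ← ha, Measure.map_apply (by fun_prop) ht]
    congr 1
    ext b
    simp [Set.mem_preimage.1 hs']
  · rw [Set.indicator_of_notMem hs', zero_mul]
    have : (Prod.mk a ⁻¹' ((fun z : A × B => (h z.1, f z)) ⁻¹' s ×ˢ t)) = ∅ := by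
      ext b
      simp only [Set.mem_preimage, Set.mem_prod, Set.mem_empty_iff_false, iff_false, not_and]
      exact fun h' => absurd h' hs'
    rw [this, measure_empty]

/-- If `f (a, ·)` has the same law `m` for almost every `a`, then `f` has law `m`. -/
theorem map_eq_of_ae_map_eq {A B D : Type*} [MeasurableSpace A] [MeasurableSpace B]
    [MeasurableSpace D] {μ : Measure A} {ν : Measure B} {m : Measure D}
    [IsProbabilityMeasure μ] [IsProbabilityMeasure ν] [IsProbabilityMeasure m]
    {f : A × B → D} (hf : Measurable f) (hm : ∀ᵐ a ∂μ, ν.map (fun b => f (a, b)) = m) :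
    (μ.prod ν).map f = m := by
  have h1 := congrArg (Measure.map Prod.snd) (map_prod_of_ae_map_eq measurable_id hf hm)
  rw [Measure.map_map measurable_snd (by fun_prop), Measure.map_snd_prod, Measure.map_id,
    measure_univ, one_smul] at h1
  exact h1

/-! ### Complex Gaussian laws -/

theorem measurable_mk_complex : Measurable fun z : ℝ × ℝ => (⟨z.1, z.2⟩ : ℂ) :=
  Complex.measurableEquivRealProd.symm.measurable

instance (v : ℝ) : IsProbabilityMeasure (complexGaussian v) :=
  Measure.isProbabilityMeasure_map measurable_mk_complex.aemeasurable

instance (n : ℕ) (v : ℝ) : IsProbabilityMeasure (complexGaussianVec n v) := by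
  unfold complexGaussianVec
  infer_instance

theorem charFunDual_complexGaussian {v : ℝ} (hv : 0 ≤ v) (L : StrongDual ℝ ℂ) :
    charFunDual (complexGaussian v) L
      = Complex.exp (-(v / 4 * (L 1 ^ 2 + L Complex.I ^ 2) : ℝ)) := by
  have hL : ∀ z : ℝ × ℝ, L ⟨z.1, z.2⟩ = z.1 * L 1 + z.2 * L Complex.I := by
    intro z
    have : (⟨z.1, z.2⟩ : ℂ) = z.1 • (1 : ℂ) + z.2 • Complex.I := by
      apply Complex.ext <;> simp
    rw [this, map_add, map_smul, map_smul, smul_eq_mul, smul_eq_mul]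
  have hc : ∀ t : ℝ, ∫ x : ℝ, Complex.exp ((x * t : ℝ) * Complex.I)
      ∂(gaussianReal 0 (v / 2).toNNReal) = Complex.exp (-(v / 4 * t ^ 2 : ℝ)) := by
    intro t
    have := charFun_gaussianReal (μ := 0) (v := (v / 2).toNNReal) t
    rw [charFun_apply_real] at this
    have h2 : (((v / 2).toNNReal : ℝ) : ℂ) = ((v / 2 : ℝ) : ℂ) := by
      rw [Real.coe_toNNReal _ (by positivity)]
    refine Eq.trans ?_ (this.trans ?_)
    · congr 1
      ext x
      push_cast
      ring_nf
    · rw [h2]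
      congr 1
      push_cast
      ring
  rw [charFunDual_apply, complexGaussian, integral_map measurable_mk_complex.aemeasurable
    (Continuous.aestronglyMeasurable (by fun_prop))]
  simp_rw [hL]
  have : ∀ z : ℝ × ℝ, Complex.exp (((z.1 * L 1 + z.2 * L Complex.I : ℝ) : ℂ) * Complex.I)
      = Complex.exp (((z.1 * L 1 : ℝ) : ℂ) * Complex.I)
        * Complex.exp (((z.2 * L Complex.I : ℝ) : ℂ) * Complex.I) := by
    intro z
    rw [← Complex.exp_add]
    push_cast
    ring_nf
  simp_rw [this]
  rw [integral_prod_mul (μ := gaussianReal 0 (v / 2).toNNReal)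
    (ν := gaussianReal 0 (v / 2).toNNReal)
    (fun x : ℝ => Complex.exp (((x * L 1 : ℝ) : ℂ) * Complex.I))
    (fun x : ℝ => Complex.exp (((x * L Complex.I : ℝ) : ℂ) * Complex.I)),
    hc, hc, ← Complex.exp_add]
  congr 1
  push_cast
  ring

/-- The complex coefficients `c` of a real functional `z ↦ ∑ Re (c i * z i)`. -/
def dualCoeff {n : ℕ} (L : StrongDual ℝ (Fin n → ℂ)) : Fin n → ℂ := fun i =>
  ⟨L (Pi.single i 1), -L (Pi.single i Complex.I)⟩

theorem dual_single {n : ℕ} (L : StrongDual ℝ (Fin n → ℂ)) (i : Fin n) (z : ℂ) :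
    L (Pi.single i z) = (dualCoeff L i * z).re := by
  have : (Pi.single i z : Fin n → ℂ)
      = z.re • (Pi.single i 1 : Fin n → ℂ) + z.im • (Pi.single i Complex.I : Fin n → ℂ) := by
    rw [← Pi.single_smul, ← Pi.single_smul, ← Pi.single_add]
    congr 1
    apply Complex.ext <;> simp
  rw [this, map_add, map_smul, map_smul]
  simp [dualCoeff]
  ring

/-- The characteristic function sees the functional only through the Euclidean norm of its
coefficients. This is the source of all the unitary invariance used below. -/
theorem charFunDual_complexGaussianVec {n : ℕ} {v : ℝ} (hv : 0 ≤ v)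
    (L : StrongDual ℝ (Fin n → ℂ)) :
    charFunDual (complexGaussianVec n v) L
      = Complex.exp (-(v / 4 * ∑ i, Complex.normSq (dualCoeff L i) : ℝ)) := by
  rw [complexGaussianVec, charFunDual_pi]
  simp_rw [charFunDual_complexGaussian hv]
  rw [← Complex.exp_sum]
  congr 1
  rw [Finset.mul_sum]
  push_cast
  rw [← Finset.sum_neg_distrib]
  refine Finset.sum_congr rfl fun i _ => ?_
  simp [dualCoeff, Complex.normSq_apply]
  exact Or.inl (by ring)

/-- The image of the law `CN(0, v I)` under a matrix with orthogonal rows of equal norms. -/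
theorem complexGaussianVec_map_mulVec {m n : ℕ} {v v' : ℝ} (hv : 0 ≤ v) (hv' : 0 ≤ v')
    (M : Matrix (Fin m) (Fin n) ℂ)
    (hM : (v : ℂ) • (M * M.conjTranspose) = (v' : ℂ) • (1 : Matrix (Fin m) (Fin m) ℂ)) :
    (complexGaussianVec n v).map (fun z => M.mulVec z) = complexGaussianVec m v' := by
  let T : (Fin n → ℂ) →L[ℝ] (Fin m → ℂ) :=
    LinearMap.toContinuousLinearMap ((Matrix.mulVecLin M).restrictScalars ℝ)
  have hT : ∀ z, T z = M.mulVec z := fun z => rfl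
  have hTf : (fun z => M.mulVec z) = T := rfl
  have := Measure.isProbabilityMeasure_map (μ := complexGaussianVec n v)
    T.continuous.aemeasurable
  rw [hTf]
  refine Measure.ext_of_charFunDual (funext fun L => ?_)
  rw [charFunDual_map, charFunDual_complexGaussianVec hv, charFunDual_complexGaussianVec hv']
  -- Pulling a functional back along $M$ multiplies its coefficient row by $M$ on the right, so its
  -- squared norm becomes $cMM^{H}c^{H}$, which `hM` evaluates.
  have hcoef : dualCoeff (L.comp T) = Matrix.vecMul (dualCoeff L) M := by
    have h1 : ∀ (j : Fin n) (z : ℂ),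
        L (T (Pi.single j z)) = ((Matrix.vecMul (dualCoeff L) M) j * z).re := by
      intro j z
      rw [hT, ← Finset.univ_sum_single (M.mulVec (Pi.single j z)), map_sum]
      simp only [dual_single, Matrix.mulVec_single, Matrix.vecMul,
        dotProduct, Finset.sum_mul, Complex.re_sum]
      refine Finset.sum_congr rfl fun i _ => ?_
      simp [Matrix.col_apply, mul_assoc]
    funext j
    apply Complex.ext
    · simp [dualCoeff, h1]
    · simp [dualCoeff, h1]
  have hnorm : ∀ {q : ℕ} (c : Fin q → ℂ), ((∑ i, Complex.normSq (c i) : ℝ) : ℂ) = c ⬝ᵥ star c := by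
    intro q c
    simp [dotProduct, Complex.mul_conj]
  have hkey : v * ∑ i, Complex.normSq (dualCoeff (L.comp T) i)
      = v' * ∑ i, Complex.normSq (dualCoeff L i) := by
    have : ((v * ∑ i, Complex.normSq (dualCoeff (L.comp T) i) : ℝ) : ℂ)
        = ((v' * ∑ i, Complex.normSq (dualCoeff L i) : ℝ) : ℂ) := by
      rw [Complex.ofReal_mul, Complex.ofReal_mul, hnorm, hnorm, hcoef, Matrix.star_vecMul,
        ← Matrix.dotProduct_mulVec, Matrix.mulVec_mulVec, ← smul_eq_mul, ← smul_eq_mul,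
        ← dotProduct_smul, ← dotProduct_smul, ← Matrix.smul_mulVec, hM, Matrix.smul_mulVec,
        Matrix.one_mulVec]
    exact_mod_cast this
  congr 2
  congr 1
  linear_combination hkey / 4

/-- `⟨r, g⟩ ∼ CN(0, v ‖r‖²)` for `g ∼ CN(0, v I)`. -/
theorem complexGaussianVec_map_dotProduct {n : ℕ} {v v' : ℝ} (hv : 0 ≤ v) (hv' : 0 ≤ v')
    (r : Fin n → ℂ) (hr : v * ∑ j, ‖r j‖ ^ 2 = v') :
    (complexGaussianVec n v).map (fun z => r ⬝ᵥ z) = complexGaussian v' := by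
  -- A single row is trivially orthogonal to the others: $r$ is taken as a $1\times n$ matrix.
  have h := complexGaussianVec_map_mulVec hv hv' (Matrix.of fun _ : Fin 1 => r) (by
    ext i j
    have hij : i = j := Subsingleton.elim _ _
    subst hij
    simp [Matrix.mul_apply, ← hr, Complex.mul_conj, Complex.normSq_eq_norm_sq])
  have h2 := congrArg (Measure.map (fun w : Fin 1 → ℂ => w 0)) h
  rw [Measure.map_map (by fun_prop) (Continuous.measurable (by fun_prop)), complexGaussianVec,
    complexGaussianVec,
    (measurePreserving_eval (fun _ : Fin 1 => complexGaussian v') 0).map_eq] at h2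
  exact h2

theorem complexGaussian_map_mul {v : ℝ} (hv : 0 ≤ v) :
    (complexGaussian 1).map (fun z => (Real.sqrt v : ℂ) * z) = complexGaussian v := by
  have h := complexGaussianVec_map_dotProduct (n := 1) zero_le_one hv
    (fun _ => (Real.sqrt v : ℂ)) (by simp [Real.sq_sqrt hv])
  rw [← h, complexGaussianVec]
  conv_lhs => rw [← (measurePreserving_eval (fun _ : Fin 1 => complexGaussian 1) 0).map_eq]
  rw [Measure.map_map (by fun_prop) (by fun_prop)]
  congr 1
  ext z
  simp [dotProduct]

theorem integral_exp_neg_sq_gaussian {ξ : ℝ} (hξ : 0 ≤ ξ) :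
    ∫ x, Real.exp (-(ξ * x ^ 2)) ∂(gaussianReal 0 (1 / 2 : ℝ).toNNReal)
      = (Real.sqrt (1 + ξ))⁻¹ := by
  have h0 : (1 / 2 : ℝ).toNNReal ≠ 0 := by simp
  rw [integral_gaussianReal_eq_integral_smul h0]
  have h1 : ∀ x : ℝ, gaussianPDFReal 0 (1 / 2 : ℝ).toNNReal x • Real.exp (-(ξ * x ^ 2))
      = (Real.sqrt Real.pi)⁻¹ * Real.exp (-(1 + ξ) * x ^ 2) := by
    intro x
    rw [gaussianPDFReal, Real.coe_toNNReal _ (by norm_num), smul_eq_mul, mul_assoc,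
      ← Real.exp_add]
    congr 2
    · congr 1
      ring
    · ring
  simp_rw [h1]
  rw [integral_const_mul, integral_gaussian, Real.sqrt_div Real.pi_pos.le]
  have := Real.sqrt_pos.2 Real.pi_pos
  field_simp

/-- The Laplace transform of `|w|²` for `w ∼ CN(0, 1)`. -/
theorem integral_exp_neg_normSq {ξ : ℝ} (hξ : 0 ≤ ξ) :
    ∫ w, Real.exp (-(ξ * ‖w‖ ^ 2)) ∂(complexGaussian 1) = (1 + ξ)⁻¹ := by
  rw [complexGaussian, integral_map measurable_mk_complex.aemeasurable
    (Continuous.aestronglyMeasurable (by fun_prop))]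
  have h1 : ∀ z : ℝ × ℝ, Real.exp (-(ξ * ‖(⟨z.1, z.2⟩ : ℂ)‖ ^ 2))
      = Real.exp (-(ξ * z.1 ^ 2)) * Real.exp (-(ξ * z.2 ^ 2)) := by
    intro z
    rw [← Complex.normSq_eq_norm_sq, Complex.normSq_mk, ← Real.exp_add]
    ring_nf
  simp_rw [h1]
  rw [integral_prod_mul (fun x : ℝ => Real.exp (-(ξ * x ^ 2)))
    (fun x : ℝ => Real.exp (-(ξ * x ^ 2))), integral_exp_neg_sq_gaussian hξ, ← mul_inv,
    Real.mul_self_sqrt (by positivity)]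

/-- The Laplace transform of a weighted sum of independent `|w i|²`. -/
theorem integral_exp_neg_weighted_sum {ι : Type*} [Fintype ι] {a : ι → ℝ} (ha : ∀ i, 0 ≤ a i)
    {ξ : ℝ} (hξ : 0 ≤ ξ) :
    ∫ w : ι → ℂ, Real.exp (-(ξ * ∑ i, a i * ‖w i‖ ^ 2)) ∂(Measure.pi fun _ => complexGaussian 1)
      = (∏ i, (1 + ξ * a i))⁻¹ := by
  have h1 : ∀ w : ι → ℂ, Real.exp (-(ξ * ∑ i, a i * ‖w i‖ ^ 2))
      = ∏ i, Real.exp (-(ξ * a i * ‖w i‖ ^ 2)) := by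
    intro w
    rw [← Real.exp_sum, Finset.mul_sum, Finset.sum_neg_distrib]
    simp only [mul_assoc]
  simp_rw [h1]
  rw [integral_fintype_prod_eq_prod (fun i (z : ℂ) => Real.exp (-(ξ * a i * ‖z‖ ^ 2))),
    ← Finset.prod_inv_distrib]
  exact Finset.prod_congr rfl fun i _ => integral_exp_neg_normSq (mul_nonneg hξ (ha i))

theorem complexGaussian_singleton {v : ℝ} (hv : 0 < v) (z : ℂ) : complexGaussian v {z} = 0 := by
  have h0 : (v / 2).toNNReal ≠ 0 := by simpa using hv
  have := nullSingletonClass_gaussianReal (μ := 0) h0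
  rw [complexGaussian, Measure.map_apply measurable_mk_complex (measurableSet_singleton _)]
  refine measure_mono_null (t := {z.re} ×ˢ Set.univ) ?_ ?_
  · rintro ⟨a, b⟩ h
    simp only [Set.mem_preimage, Set.mem_singleton_iff] at h
    simp [← h]
  · rw [Measure.prod_prod, measure_singleton, zero_mul]

theorem ae_ne_zero_pi_complexGaussian {ι : Type*} [Fintype ι] [Nonempty ι] {v : ℝ} (hv : 0 < v) :
    ∀ᵐ w : ι → ℂ ∂(Measure.pi fun _ => complexGaussian v), ∃ i, w i ≠ 0 := by
  obtain ⟨i⟩ := ‹Nonempty ι›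
  have h := (measurePreserving_eval (fun _ : ι => complexGaussian v) i).quasiMeasurePreserving.ae
    (p := fun z => z ≠ 0) (by
      rw [ae_iff]
      simpa using complexGaussian_singleton hv 0)
  filter_upwards [h] with w hw
  exact ⟨i, hw⟩

/-! ### Pseudo-inverses of matrices with independent columns -/

/-- The matrix with columns `g j`. -/
def colMat {n m : ℕ} (g : Fin m → Fin n → ℂ) : Matrix (Fin n) (Fin m) ℂ :=
  Matrix.of fun i j => g j i

/-- The left inverse `(Aᴴ A)⁻¹ Aᴴ` of a matrix with independent columns. -/
def leftInv {n m : ℕ} (A : Matrix (Fin n) (Fin m) ℂ) : Matrix (Fin m) (Fin n) ℂ :=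
  (A.conjTranspose * A)⁻¹ * A.conjTranspose

open scoped ComplexOrder in
theorem isUnit_det_gram {n m : ℕ} {g : Fin m → Fin n → ℂ} (hg : LinearIndependent ℂ g) :
    IsUnit ((colMat g).conjTranspose * colMat g).det := by
  have hinj : Function.Injective (colMat g).mulVec := Matrix.mulVec_injective_iff.2 hg
  exact (Matrix.isUnit_iff_isUnit_det _).1
    (Matrix.PosDef.conjTranspose_mul_self _ hinj).isUnit

theorem leftInv_mul {n m : ℕ} {g : Fin m → Fin n → ℂ} (hg : LinearIndependent ℂ g) :
    leftInv (colMat g) * colMat g = 1 := by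
  rw [leftInv, Matrix.mul_assoc, Matrix.nonsing_inv_mul _ (isUnit_det_gram hg)]

theorem isHermitian_gram_inv {n m : ℕ} (A : Matrix (Fin n) (Fin m) ℂ) :
    ((A.conjTranspose * A)⁻¹).IsHermitian :=
  (Matrix.isHermitian_conjTranspose_mul_self A).inv

theorem pinv_eq_leftInv {n m : ℕ} {g : Fin m → Fin n → ℂ} (hg : LinearIndependent ℂ g) :
    pinv (colMat g) = leftInv (colMat g) := by
  have hspec : IsPseudoinverse (colMat g) (pinv (colMat g)) :=
    (exists_isPseudoinverse (colMat g)).choose_spec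
  refine hspec.unique ⟨?_, ?_, ?_, ?_⟩
  · rw [Matrix.mul_assoc, leftInv_mul hg, Matrix.mul_one]
  · rw [leftInv_mul hg, Matrix.one_mul]
  · rw [leftInv, ← Matrix.mul_assoc]
    exact Matrix.isHermitian_mul_mul_conjTranspose _ (isHermitian_gram_inv _)
  · rw [leftInv_mul hg]
    exact Matrix.isHermitian_one

/-- A coisometry onto the orthogonal complement of the span of independent vectors. -/
theorem exists_complement_coisometry {n N : ℕ} {v : Fin n → Fin N → ℂ}
    (hv : LinearIndependent ℂ v) :
    ∃ M : Matrix (Fin (N - n)) (Fin N) ℂ, M * M.conjTranspose = 1 ∧ (∀ j, M.mulVec (v j) = 0) ∧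
      ∀ z : Fin N → ℂ, (∀ j, star (v j) ⬝ᵥ z = 0) → M.conjTranspose.mulVec (M.mulVec z) = z := by
  let e := (WithLp.linearEquiv 2 ℂ (Fin N → ℂ)).symm
  let v' : Fin n → EuclideanSpace ℂ (Fin N) := fun j => e (v j)
  have hv' : LinearIndependent ℂ v' := hv.map' e.toLinearMap e.ker
  set W : Submodule ℂ (EuclideanSpace ℂ (Fin N)) := Submodule.span ℂ (Set.range v') with hW
  have hrank : Module.finrank ℂ Wᗮ = N - n := by
    have h1 := W.finrank_add_finrank_orthogonal
    have h2 : Module.finrank ℂ W = n := by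
      rw [hW, finrank_span_eq_card hv', Fintype.card_fin]
    rw [h2, finrank_euclideanSpace_fin] at h1
    omega
  -- The rows of $M$ are the conjugates of an orthonormal basis of $W^\perp$. Thus $Mz$ lists the
  -- coordinates of the projection of $z$, and $M^{H}M$ is that projection.
  let b : OrthonormalBasis (Fin (N - n)) ℂ Wᗮ :=
    (stdOrthonormalBasis ℂ Wᗮ).reindex (finCongr hrank)
  have hip : ∀ x y : EuclideanSpace ℂ (Fin N), inner ℂ x y = ∑ j, star (x j) * y j := by
    intro x y
    simp [PiLp.inner_apply, mul_comm]
  let M : Matrix (Fin (N - n)) (Fin N) ℂ := Matrix.of fun i j => star ((b i : EuclideanSpace ℂ _) j)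
  have hM : ∀ z i, M.mulVec z i = inner ℂ (b i : EuclideanSpace ℂ (Fin N)) (e z) := by
    intro z i
    rw [hip]
    rfl
  refine ⟨M, ?_, ?_, ?_⟩
  · ext i i'
    have h1 := orthonormal_iff_ite.1 b.orthonormal i i'
    rw [Submodule.coe_inner, hip] at h1
    rw [Matrix.mul_apply, Matrix.one_apply, ← h1]
    simp [M, Matrix.conjTranspose_apply]
  · intro j
    ext i
    rw [hM, Pi.zero_apply]
    exact Submodule.inner_left_of_mem_orthogonal (K := W)
      (Submodule.subset_span (Set.mem_range_self j)) (b i).2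
  · intro z hz
    have hzW : e z ∈ Wᗮ := by
      rw [hW, Submodule.mem_orthogonal]
      intro u hu
      induction hu using Submodule.span_induction with
      | mem x hx =>
        obtain ⟨j, rfl⟩ := hx
        rw [hip]
        exact hz j
      | zero => simp
      | add x y _ _ hx hy => rw [inner_add_left, hx, hy, add_zero]
      | smul c x _ hx => rw [inner_smul_left, hx, mul_zero]
    have h1 := congrArg (fun x : Wᗮ => (x : EuclideanSpace ℂ (Fin N))) (b.sum_repr' (⟨e z, hzW⟩ : Wᗮ))
    simp only [Submodule.coe_sum, Submodule.coe_smul, Submodule.coe_inner] at h1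
    ext a
    have h2 := congrArg (fun x : EuclideanSpace ℂ (Fin N) => x a) h1
    have h3 : e z a = z a := rfl
    simp only [PiLp.smul_apply, smul_eq_mul, h3, WithLp.ofLp_sum, Finset.sum_apply] at h2
    rw [← h2, Matrix.mulVec, dotProduct]
    refine Finset.sum_congr rfl fun i _ => ?_
    rw [hM, Matrix.conjTranspose_apply]
    simp [M, mul_comm]

theorem sum_norm_sq_eq_dotProduct {n : ℕ} (c : Fin n → ℂ) :
    ((∑ i, ‖c i‖ ^ 2 : ℝ) : ℂ) = star c ⬝ᵥ c := by
  simp [dotProduct, Complex.conj_mul']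

theorem rowNormSq_leftInv_pos {n N : ℕ} {g : Fin n → Fin N → ℂ} (hg : LinearIndependent ℂ g)
    (k : Fin n) : 0 < rowNormSq (leftInv (colMat g)) k := by
  have hnn : 0 ≤ rowNormSq (leftInv (colMat g)) k := Finset.sum_nonneg fun _ _ => by positivity
  refine hnn.lt_of_ne fun h0 => ?_
  have hrow : ∀ j, leftInv (colMat g) k j = 0 := by
    intro j
    have := (Finset.sum_eq_zero_iff_of_nonneg fun i _ => by positivity).1 h0.symm j
      (Finset.mem_univ j)
    simpa using this
  have h1 := congrFun (congrFun (leftInv_mul hg) k) k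
  rw [Matrix.mul_apply, Matrix.one_apply_eq] at h1
  simp [hrow] at h1

/-- The squared norm of row `k` of the left inverse is the inverse of the squared distance of
column `k` to the span of the other columns. -/
theorem rowNormSq_leftInv_mul {n q N : ℕ} {g : Fin (n + 1) → Fin N → ℂ}
    (hg : LinearIndependent ℂ g) (k : Fin (n + 1)) {M : Matrix (Fin q) (Fin N) ℂ}
    (hM0 : ∀ j, M.mulVec (g (k.succAbove j)) = 0)
    (hM : ∀ z : Fin N → ℂ, (∀ j, star (g (k.succAbove j)) ⬝ᵥ z = 0) →
      M.conjTranspose.mulVec (M.mulVec z) = z) :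
    rowNormSq (leftInv (colMat g)) k * ∑ i, ‖M.mulVec (g k) i‖ ^ 2 = 1 := by
  set A := colMat g with hA
  set B := leftInv A with hB
  set R := (A.conjTranspose * A)⁻¹ with hR
  set rho := rowNormSq B k with hrho
  have hBA : B * A = 1 := leftInv_mul hg
  have hBH : B.conjTranspose = A * R := by
    rw [hB, leftInv, Matrix.conjTranspose_mul, Matrix.conjTranspose_conjTranspose,
      (isHermitian_gram_inv A).eq]
  have hBBH : B * B.conjTranspose = R := by
    rw [hBH, ← Matrix.mul_assoc, hBA, Matrix.one_mul]
  -- The conjugated row $z$ is dual to the columns: orthogonal to all $g_j$ with $j\ne k$, and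
  -- $\langle g_k,z\rangle=1$. It also lies in the column space, with $g_k$-coefficient
  -- $R_{kk}=\rho$. Hence $Mz=\rho\,Mg_k$, and since $M^{H}M$ fixes $z$,
  -- $\rho=\|Mz\|^2=\rho^2\|Mg_k\|^2$.
  set z : Fin N → ℂ := star (B.row k) with hz
  have hzcol : z = B.conjTranspose.mulVec (Pi.single k 1) := by
    ext i
    simp [hz]
  have hzz : star z ⬝ᵥ z = rho := by
    rw [← sum_norm_sq_eq_dotProduct, hrho, rowNormSq]
    congr 1
    simp [hz]
  have hgz : ∀ j, star (g j) ⬝ᵥ z = if j = k then 1 else 0 := by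
    intro j
    have h1 := congrFun (congrFun hBA k) j
    rw [Matrix.mul_apply, Matrix.one_apply] at h1
    have h2 := congrArg star h1
    simp only [star_sum, star_mul'] at h2
    rw [dotProduct]
    refine Eq.trans (Finset.sum_congr rfl fun i _ => ?_) (h2.trans ?_)
    · simp [hz, hA, colMat, mul_comm]
    · by_cases h : j = k
      · simp [h]
      · simp [h, Ne.symm h]
  have hproj : M.conjTranspose.mulVec (M.mulVec z) = z := hM z fun j => by
    rw [hgz, if_neg (Fin.succAbove_ne k j)]
  have hRk : R k k = rho := by
    rw [← hBBH, ← hzz, Matrix.mul_apply, dotProduct]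
    simp [hz]
  have hMz : M.mulVec z = (rho : ℂ) • M.mulVec (g k) := by
    rw [hzcol, hBH, ← Matrix.mulVec_mulVec]
    set a := R.mulVec (Pi.single k 1) with ha
    have hak : a k = rho := by rw [← hRk, ha]; simp
    have hAa : A.mulVec a = ∑ j, a j • g j := by
      ext i
      simp [Matrix.mulVec, dotProduct, hA, colMat, mul_comm]
    rw [hAa, Matrix.mulVec_sum, Fin.sum_univ_succAbove _ k, Matrix.mulVec_smul, hak]
    simp [Matrix.mulVec_smul, hM0]
  have hfin : (rho : ℂ) = rho ^ 2 * ((∑ i, ‖M.mulVec (g k) i‖ ^ 2 : ℝ) : ℂ) := by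
    rw [sum_norm_sq_eq_dotProduct, ← hzz]
    nth_rw 1 [← hproj]
    rw [hzz, Matrix.star_mulVec, Matrix.conjTranspose_conjTranspose, ← Matrix.dotProduct_mulVec,
      hMz]
    simp [smul_dotProduct, dotProduct_smul]
    ring
  have hrho0 : rho ≠ 0 := (rowNormSq_leftInv_pos hg k).ne'
  have hfin' : rho = rho ^ 2 * ∑ i, ‖M.mulVec (g k) i‖ ^ 2 := by exact_mod_cast hfin
  have : rho * (rho * ∑ i, ‖M.mulVec (g k) i‖ ^ 2) = rho * 1 := by linarith
  exact mul_left_cancel₀ hrho0 this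

/-! ### Almost sure independence of Gaussian columns -/

theorem measurableSet_linearIndependent (n N : ℕ) :
    MeasurableSet {g : Fin n → Fin N → ℂ | LinearIndependent ℂ g} :=
  isOpen_setOfPred_linearIndependent.measurableSet

/-- Induction on the number of columns: given independent columns, the component of a new Gaussian
column in their orthogonal complement is a Gaussian vector of dimension $N-n>0$, hence almost surely
nonzero. -/
theorem ae_linearIndependent {N : ℕ} : ∀ {n : ℕ} (_ : n ≤ N) {b : Fin n → ℝ} (_ : ∀ i, 0 < b i),
    ∀ᵐ g ∂(Measure.pi fun i => complexGaussianVec N (b i)), LinearIndependent ℂ g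
  | 0, _, _, _ => ae_of_all _ fun _ => linearIndependent_empty_type
  | n + 1, hn, b, hb => by
    have hmp := measurePreserving_piFinSuccAbove (fun i => complexGaussianVec N (b i)) 0
    have hrec := ae_linearIndependent (N := N) (n := n) (by omega) (b := fun i => b (Fin.succ i))
      fun i => hb _
    have hms : MeasurableSet {x : (Fin N → ℂ) × (Fin n → Fin N → ℂ) | LinearIndependent ℂ
        ((MeasurableEquiv.piFinSuccAbove (fun _ : Fin (n + 1) => Fin N → ℂ) 0).symm x)} :=
      hmp.symm.measurable (measurableSet_linearIndependent _ _)
    rw [← hmp.symm.map_eq, ae_map_iff hmp.symm.measurable.aemeasurable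
      (measurableSet_linearIndependent _ _)]
    -- The swap puts the old columns first, so that Fubini conditions on them and leaves the new
    -- column random.
    rw [← Measure.prod_swap, ae_map_iff measurable_swap.aemeasurable hms]
    refine (Measure.ae_prod_iff_ae_ae (measurable_swap hms)).2 ?_
    have hrec' : ∀ᵐ v ∂(Measure.pi fun j : Fin n =>
        complexGaussianVec N (b (Fin.succAbove 0 j))), LinearIndependent ℂ v := hrec
    filter_upwards [hrec'] with v hv
    obtain ⟨M, hM1, hM0, -⟩ := exists_complement_coisometry hv
    have hlaw := complexGaussianVec_map_mulVec (hb 0).le (hb 0).le M (by rw [hM1])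
    have : Nonempty (Fin (N - n)) := ⟨⟨0, by omega⟩⟩
    have hne := ae_ne_zero_pi_complexGaussian (ι := Fin (N - n)) (hb 0)
    rw [← complexGaussianVec, ← hlaw] at hne
    have hne' := ae_of_ae_map (Continuous.aemeasurable (by fun_prop)) hne
    filter_upwards [hne'] with y hy
    have hcons : (MeasurableEquiv.piFinSuccAbove (fun _ : Fin (n + 1) => Fin N → ℂ) 0).symm
        (Prod.swap (v, y)) = Fin.cons y v := by
      simp [MeasurableEquiv.piFinSuccAbove, Fin.consEquiv]
    rw [hcons]
    refine linearIndependent_finCons.2 ⟨hv, fun hmem => ?_⟩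
    obtain ⟨i, hi⟩ := hy
    apply hi
    have hle : Submodule.span ℂ (Set.range v) ≤ LinearMap.ker M.mulVecLin :=
      Submodule.span_le.2 (by rintro _ ⟨j, rfl⟩; exact hM0 j)
    exact congrFun (hle hmem) i

/-! ### Identification of densities by Laplace transforms -/

/-- A real integrable function on `[0, ∞)` with the Laplace transform of a finite measure is a
density of this measure. -/
theorem withDensity_eq_of_laplace {f : ℝ → ℝ} (hfm : Measurable f) (hfi : Integrable f)
    (hf0 : ∀ x < 0, f x = 0) {m : Measure ℝ} [IsFiniteMeasure m] (hm : ∀ᵐ x ∂m, 0 ≤ x)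
    (h : ∀ n : ℕ, ∫ y, Real.exp (-(n * y)) * f y = ∫ y, Real.exp (-(n * y)) ∂m) :
    (volume.withDensity fun y => ENNReal.ofReal (f y)) = m := by
  -- The sign of $f$ is not assumed; for `pdfY` it is not evident, since partial fraction
  -- coefficients may be negative. With $f^+$ and $f^-$ as densities, the Laplace transforms give
  -- $m+f^-=f^+$. As $f^+$ has no mass on $\{f<0\}$, neither does $f^-$, so $f^-=0$.
  set mp := volume.withDensity fun y => ENNReal.ofReal (f y) with hmp
  set mn := volume.withDensity fun y => ENNReal.ofReal (-f y) with hmn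
  have : IsFiniteMeasure mp := isFiniteMeasure_withDensity_ofReal hfi.2
  have : IsFiniteMeasure mn := isFiniteMeasure_withDensity_ofReal hfi.neg.2
  have hsupp : ∀ g : ℝ → ℝ, Measurable g → (∀ x < 0, g x = 0) →
      ∀ᵐ x ∂(volume.withDensity fun y => ENNReal.ofReal (g y)), 0 ≤ x := by
    intro g hg hg0
    rw [ae_withDensity_iff (by fun_prop)]
    refine ae_of_all _ fun x hx => ?_
    by_contra hneg
    exact hx (by rw [hg0 x (not_le.1 hneg), ENNReal.ofReal_zero])
  have hbd : ∀ (n : ℕ) (x : ℝ), 0 ≤ x → ‖Real.exp (-(n * x))‖ ≤ 1 := by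
    intro n x hx
    rw [Real.norm_eq_abs, abs_of_pos (Real.exp_pos _), Real.exp_le_one_iff, neg_nonpos]
    positivity
  have hint : ∀ (μ : Measure ℝ) [IsFiniteMeasure μ], (∀ᵐ x ∂μ, 0 ≤ x) → ∀ n : ℕ,
      Integrable (fun x : ℝ => Real.exp (-(n * x))) μ := by
    intro μ _ hμ n
    refine Integrable.of_bound (Continuous.aestronglyMeasurable (by fun_prop)) 1 ?_
    filter_upwards [hμ] with x hx using hbd n x hx
  have hpos := hsupp f hfm hf0
  have hfm' : Measurable fun x => -f x := hfm.neg
  have hneg := hsupp (fun x => -f x) hfm' fun x hx => by simp [hf0 x hx]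
  have hwd : ∀ (g : ℝ → ℝ), Measurable g → ∀ n : ℕ,
      ∫ y, Real.exp (-(n * y)) ∂(volume.withDensity fun y => ENNReal.ofReal (g y))
        = ∫ y, (max (g y) 0) * Real.exp (-(n * y)) := by
    intro g hg n
    rw [integral_withDensity_eq_integral_toReal_smul (by fun_prop)
      (ae_of_all _ fun _ => ENNReal.ofReal_lt_top)]
    simp only [ENNReal.toReal_ofReal', smul_eq_mul]
  have hsm : ∀ g : ℝ → ℝ, Integrable g → (∀ x < 0, g x = 0) → ∀ n : ℕ,
      Integrable fun y => (max (g y) 0) * Real.exp (-(n * y)) := by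
    intro g hg hg0 n
    refine Integrable.mono' hg.norm
      (((hg.1.sup aestronglyMeasurable_const)).mul
        (Continuous.aestronglyMeasurable (by fun_prop))) (ae_of_all _ fun x => ?_)
    rcases lt_or_ge x 0 with hx | hx
    · simp [hg0 x hx]
    · rw [norm_mul]
      have h1 : ‖max (g x) 0‖ ≤ ‖g x‖ := by
        rw [Real.norm_eq_abs, Real.norm_eq_abs, abs_of_nonneg (le_max_right _ _)]
        exact max_le (le_abs_self _) (abs_nonneg _)
      exact (mul_le_mul h1 (hbd n x hx) (norm_nonneg _) (norm_nonneg _)).trans_eq (mul_one _)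
  have hsum : m + mn = mp := by
    refine ext_of_laplace ?_ hpos fun n => ?_
    · rw [ae_add_measure_iff]
      exact ⟨hm, hneg⟩
    · rw [integral_add_measure (hint m hm n) (hint mn hneg n), hwd f hfm, hwd _ hfm', ← h n,
        ← eq_sub_iff_add_eq, ← integral_sub (hsm f hfi hf0 n)
          (hsm (fun x => -f x) hfi.neg (fun x hx => by simp [hf0 x hx]) n)]
      refine integral_congr_ae (ae_of_all _ fun x => ?_)
      simp only
      rcases le_total (f x) 0 with hx | hx
      · rw [max_eq_right hx, max_eq_left (by linarith)]
        ring
      · rw [max_eq_left hx, max_eq_right (by linarith)]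
        ring
  have hS : MeasurableSet {x | f x < 0} := measurableSet_lt hfm measurable_const
  have hmn0 : mn = 0 := by
    have h1 : mn {x | f x < 0} = 0 := by
      have h2 : mp {x | f x < 0} = 0 := by
        rw [hmp, withDensity_apply _ hS]
        refine (setLIntegral_congr_fun hS fun x hx => ?_).trans lintegral_zero
        have : f x < 0 := hx
        exact ENNReal.ofReal_of_nonpos this.le
      rw [← hsum] at h2
      exact (add_eq_zero.1 h2).2
    have h3 : mn {x | f x < 0}ᶜ = 0 := by
      rw [hmn, withDensity_apply _ hS.compl]
      refine (setLIntegral_congr_fun hS.compl fun x hx => ?_).trans lintegral_zero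
      have : 0 ≤ f x := not_lt.1 hx
      exact ENNReal.ofReal_of_nonpos (by linarith)
    rw [← Measure.measure_univ_eq_zero, ← Set.union_compl_self {x | f x < 0}]
    exact le_antisymm ((measure_union_le _ _).trans (by rw [h1, h3, add_zero])) bot_le
  rw [← hsum, hmn0, add_zero]

/-- The density of the Erlang law with shape `m + 1` and scale `b`. -/
def erlangPDF (m : ℕ) (b y : ℝ) : ℝ :=
  if 0 ≤ y then (b ^ (m + 1))⁻¹ / m.factorial * y ^ m * Real.exp (-y / b) else 0

theorem measurable_erlangPDF (m : ℕ) (b : ℝ) : Measurable (erlangPDF m b) :=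
  Measurable.ite measurableSet_Ici (by fun_prop) measurable_const

/-- The exponent $(m+1)-1$ is a real power, the form in which the Gamma integral applies. -/
theorem exp_mul_erlangPDF (m : ℕ) (b ξ : ℝ) :
    (fun y => Real.exp (-(ξ * y)) * erlangPDF m b y) = (Set.Ici (0 : ℝ)).indicator fun y =>
      (b ^ (m + 1))⁻¹ / m.factorial * (y ^ ((m + 1 : ℝ) - 1) * Real.exp (-((1 / b + ξ) * y))) := by
  funext y
  by_cases hy : 0 ≤ y
  · rw [Set.indicator_of_mem (Set.mem_Ici.2 hy), erlangPDF, if_pos hy, add_sub_cancel_right,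
      Real.rpow_natCast]
    have : Real.exp (-((1 / b + ξ) * y)) = Real.exp (-(ξ * y)) * Real.exp (-y / b) := by
      rw [← Real.exp_add]
      congr 1
      ring
    rw [this]
    ring
  · rw [Set.indicator_of_notMem (by simpa using hy), erlangPDF, if_neg hy, mul_zero]

theorem integrable_exp_mul_erlangPDF (m : ℕ) {b ξ : ℝ} (hb : 0 < b) (hξ : 0 ≤ ξ) :
    Integrable fun y => Real.exp (-(ξ * y)) * erlangPDF m b y := by
  rw [exp_mul_erlangPDF, integrable_indicator_iff measurableSet_Ici,
    integrableOn_Ici_iff_integrableOn_Ioi]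
  refine Integrable.const_mul ?_ _
  have hc : 0 < 1 / b + ξ := by positivity
  have := integrableOn_rpow_mul_exp_neg_mul_rpow (p := 1) (s := (m + 1 : ℝ) - 1) (b := 1 / b + ξ)
    (by rw [add_sub_cancel_right]; exact lt_of_lt_of_le (by norm_num) (Nat.cast_nonneg m))
    (by norm_num) hc
  refine this.congr_fun (fun y _ => ?_) measurableSet_Ioi
  simp only [Real.rpow_one, neg_mul]

theorem integrable_erlangPDF (m : ℕ) {b : ℝ} (hb : 0 < b) : Integrable (erlangPDF m b) := by
  simpa using integrable_exp_mul_erlangPDF m hb le_rfl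

theorem integral_exp_mul_erlangPDF (m : ℕ) {b ξ : ℝ} (hb : 0 < b) (hξ : 0 ≤ ξ) :
    ∫ y, Real.exp (-(ξ * y)) * erlangPDF m b y = 1 / (1 + ξ * b) ^ (m + 1) := by
  have hc : 0 < 1 / b + ξ := by positivity
  rw [exp_mul_erlangPDF, integral_indicator measurableSet_Ici, integral_Ici_eq_integral_Ioi,
    integral_const_mul, Real.integral_rpow_mul_exp_neg_mul_Ioi (by positivity) hc,
    Real.Gamma_nat_eq_factorial]
  have h1 : ((1 / (1 / b + ξ)) ^ ((m : ℝ) + 1)) = (1 / (1 / b + ξ)) ^ (m + 1) := by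
    rw [← Real.rpow_natCast]
    push_cast
    rfl
  rw [h1]
  have h2 : 1 / (1 / b + ξ) = b / (1 + ξ * b) := by
    field_simp
  rw [h2, div_pow]
  have : (m.factorial : ℝ) ≠ 0 := by positivity
  field_simp

theorem measurable_weighted_sum {ι : Type*} [Fintype ι] (a : ι → ℝ) :
    Measurable fun w : ι → ℂ => ∑ i, a i * ‖w i‖ ^ 2 := by
  fun_prop

theorem ae_nonneg_map_weighted_sum {ι : Type*} [Fintype ι] {a : ι → ℝ} (ha : ∀ i, 0 ≤ a i) :
    ∀ᵐ y ∂((Measure.pi fun _ : ι => complexGaussian 1).map fun w => ∑ i, a i * ‖w i‖ ^ 2),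
      0 ≤ y := by
  rw [ae_map_iff (measurable_weighted_sum a).aemeasurable measurableSet_Ici]
  exact ae_of_all _ fun w => Finset.sum_nonneg fun i _ => mul_nonneg (ha i) (by positivity)

theorem integral_exp_map_weighted_sum {ι : Type*} [Fintype ι] {a : ι → ℝ} (ha : ∀ i, 0 ≤ a i)
    (n : ℕ) :
    ∫ y, Real.exp (-(n * y))
        ∂((Measure.pi fun _ : ι => complexGaussian 1).map fun w => ∑ i, a i * ‖w i‖ ^ 2)
      = (∏ i, (1 + n * a i))⁻¹ := by
  rw [integral_map (measurable_weighted_sum a).aemeasurable (Continuous.aestronglyMeasurable (by fun_prop)),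
    integral_exp_neg_weighted_sum ha (Nat.cast_nonneg n)]

theorem withDensity_pdfX (N K : ℕ) {b : ℝ} (hb : 0 < b) :
    (volume.withDensity fun x => ENNReal.ofReal (pdfX N K b x))
      = (Measure.pi fun _ : Fin (N - K + 1) => complexGaussian 1).map
        fun u => ∑ i, b * ‖u i‖ ^ 2 := by
  have hpdf : pdfX N K b = erlangPDF (N - K) b := by
    funext x
    simp only [pdfX, erlangPDF]
    split_ifs
    · rw [div_pow, pow_succ]
      field_simp
    · rfl
  have := Measure.isProbabilityMeasure_map
    (μ := Measure.pi fun _ : Fin (N - K + 1) => complexGaussian 1)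
    (measurable_weighted_sum fun _ => b).aemeasurable
  rw [hpdf]
  refine withDensity_eq_of_laplace (measurable_erlangPDF _ _) (integrable_erlangPDF _ hb)
    (fun x hx => if_neg (not_le.2 hx)) (ae_nonneg_map_weighted_sum fun _ => hb.le) fun n => ?_
  rw [integral_exp_mul_erlangPDF _ hb (Nat.cast_nonneg n),
    integral_exp_map_weighted_sum fun _ => hb.le]
  simp

/-- Each partial fraction $(1+\xi\mu)^{-q}$ is the Laplace transform of the Erlang density of shape
$q$ and scale $\mu$, and the full product is the transform of $\sum_i a_i|w_i|^2$. -/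
theorem withDensity_pdfY {ι : Type*} [Fintype ι] [Nonempty ι] {a : ι → ℝ} (ha : ∀ i, 0 < a i) :
    (volume.withDensity fun y => ENNReal.ofReal (pdfY a y))
      = (Measure.pi fun _ : ι => complexGaussian 1).map fun w => ∑ i, a i * ‖w i‖ ^ 2 := by
  -- `charCoeff` is an epsilon term; it has its defining property because the expansion exists for
  -- positive $a$.
  have hχ : IsCharCoeff a (charCoeff a) := Classical.epsilon_spec (exists_isCharCoeff a ha)
  have hpos : ∀ μ ∈ distinctVals a, 0 < μ := by
    intro μ hμ
    simp only [distinctVals, Finset.mem_image, Finset.mem_univ, true_and] at hμ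
    obtain ⟨i, rfl⟩ := hμ
    exact ha i
  have hpdf : pdfY a = fun y => ∑ μ ∈ distinctVals a, ∑ q ∈ Finset.Icc 1 (mult a μ),
      charCoeff a μ q * erlangPDF (q - 1) μ y := by
    funext y
    simp only [pdfY]
    split_ifs with hy
    · refine Finset.sum_congr rfl fun μ _ => Finset.sum_congr rfl fun q hq => ?_
      rw [erlangPDF, if_pos hy, Nat.sub_add_cancel (Finset.mem_Icc.1 hq).1]
      ring
    · simp [erlangPDF, hy]
  have := Measure.isProbabilityMeasure_map
    (μ := Measure.pi fun _ : ι => complexGaussian 1)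
    (measurable_weighted_sum a).aemeasurable
  refine withDensity_eq_of_laplace (f := pdfY a) ?_ ?_
    (fun x hx => if_neg (not_le.2 hx)) (ae_nonneg_map_weighted_sum fun i => (ha i).le) fun n => ?_
  · rw [hpdf]
    have := measurable_erlangPDF
    fun_prop
  · rw [hpdf]
    exact integrable_finsetSum _ fun μ hμ => integrable_finsetSum _ fun q _ =>
      (integrable_erlangPDF _ (hpos μ hμ)).const_mul _
  · rw [integral_exp_map_weighted_sum fun i => (ha i).le, hχ n (Nat.cast_nonneg n), hpdf]
    have hI : ∀ μ ∈ distinctVals a, ∀ q, Integrable fun y =>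
        charCoeff a μ q * (Real.exp (-(n * y)) * erlangPDF (q - 1) μ y) := fun μ hμ q =>
      (integrable_exp_mul_erlangPDF _ (hpos μ hμ) (Nat.cast_nonneg n)).const_mul _
    simp only [Finset.mul_sum, mul_left_comm (Real.exp _)]
    rw [integral_finsetSum _ fun μ hμ => integrable_finsetSum _ fun q _ => hI μ hμ q]
    refine Finset.sum_congr rfl fun μ hμ => ?_
    rw [integral_finsetSum _ fun q _ => hI μ hμ q]
    refine Finset.sum_congr rfl fun q hq => ?_
    rw [integral_const_mul, integral_exp_mul_erlangPDF _ (hpos μ hμ) (Nat.cast_nonneg n),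
      Nat.sub_add_cancel (Finset.mem_Icc.1 hq).1, mul_one_div]

/-! ### Laws of the signal and noise terms -/

/-- By the cofactor formula each entry is a continuous function times the inverse of a determinant.
Real and complex inversion being total and measurable, degenerate matrices need no separate
treatment. -/
theorem measurable_leftInv {n N : ℕ} (k : Fin n) (j : Fin N) :
    Measurable fun g : Fin n → Fin N → ℂ => leftInv (colMat g) k j := by
  have hA : Continuous fun g : Fin n → Fin N → ℂ => colMat g :=
    continuous_matrix fun i j => by unfold colMat; simp only [Matrix.of_apply]; fun_prop
  have hG : Continuous fun g : Fin n → Fin N → ℂ => (colMat g).conjTranspose * colMat g :=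
    hA.matrix_conjTranspose.matrix_mul hA
  have hB : Continuous fun g : Fin n → Fin N → ℂ =>
      ((colMat g).conjTranspose * colMat g).adjugate * (colMat g).conjTranspose :=
    hG.matrix_adjugate.matrix_mul hA.matrix_conjTranspose
  have heq : (fun g : Fin n → Fin N → ℂ => leftInv (colMat g) k j) = fun g =>
      (((colMat g).conjTranspose * colMat g).det)⁻¹
        * (((colMat g).conjTranspose * colMat g).adjugate * (colMat g).conjTranspose) k j := by
    funext g
    rw [leftInv, Matrix.inv_def, Matrix.smul_mul, Matrix.smul_apply, Ring.inverse_eq_inv',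
      smul_eq_mul]
  rw [heq]
  exact (hG.matrix_det.measurable.inv).mul (hB.matrix_elem k j).measurable

theorem measurable_rowNormSq_leftInv {n N : ℕ} (k : Fin n) :
    Measurable fun g : Fin n → Fin N → ℂ => rowNormSq (leftInv (colMat g)) k := by
  unfold rowNormSq
  exact Finset.measurable_fun_sum _ fun j _ => ((measurable_leftInv k j).norm.pow_const 2)

/-- Scaling moves the variances out of the measure and into the weights, so that different variances
live on one space. -/
theorem pi_complexGaussian_map_sqrt_mul {ι : Type*} [Fintype ι] {v : ι → ℝ} (hv : ∀ i, 0 ≤ v i) :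
    (Measure.pi fun i => complexGaussian (v i)).map (fun w => ∑ i, ‖w i‖ ^ 2)
      = (Measure.pi fun _ : ι => complexGaussian 1).map (fun w => ∑ i, v i * ‖w i‖ ^ 2) := by
  have h := Measure.pi_map_pi (μ := fun _ : ι => complexGaussian 1)
    (f := fun i z => (Real.sqrt (v i) : ℂ) * z) fun i => by fun_prop
  simp only [complexGaussian_map_mul (hv _)] at h
  rw [← h, Measure.map_map (by fun_prop) (by fun_prop)]
  congr 1
  funext w
  refine Finset.sum_congr rfl fun i _ => ?_
  rw [norm_mul, mul_pow, Complex.norm_real, Real.norm_eq_abs, sq_abs, Real.sq_sqrt (hv i)]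

/-- The inverse squared norm of row `k` of the left inverse of a Gaussian matrix has the law of a
weighted sum of `q = N - n` independent `|u i|²`. -/
theorem map_inv_rowNormSq_leftInv {n N q : ℕ} (hn : n + 1 ≤ N) (hq : q = N - n)
    {b : Fin (n + 1) → ℝ} (hb : ∀ j, 0 < b j) (k : Fin (n + 1)) :
    (Measure.pi fun j => complexGaussianVec N (b j)).map
        (fun g => (rowNormSq (leftInv (colMat g)) k)⁻¹)
      = (Measure.pi fun _ : Fin q => complexGaussian 1).map fun u => ∑ i, b k * ‖u i‖ ^ 2 := by
  subst hq
  have hmp := measurePreserving_piFinSuccAbove (fun j => complexGaussianVec N (b j)) k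
  set e := MeasurableEquiv.piFinSuccAbove (fun _ : Fin (n + 1) => Fin N → ℂ) k with he
  have hf : Measurable fun g : Fin (n + 1) → Fin N → ℂ => (rowNormSq (leftInv (colMat g)) k)⁻¹ :=
    (measurable_rowNormSq_leftInv k).inv
  -- Column $k$ is placed last, to be integrated with the other columns held fixed.
  have hμ : (Measure.pi fun j => complexGaussianVec N (b j))
      = ((Measure.pi fun j => complexGaussianVec N (b (k.succAbove j))).prod
        (complexGaussianVec N (b k))).map (fun z => e.symm z.swap) := by
    rw [← hmp.symm.map_eq, ← Measure.prod_swap,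
      Measure.map_map hmp.symm.measurable measurable_swap]
    rfl
  have hli := ae_linearIndependent hn hb
  have hli' := ae_linearIndependent (N := N) (n := n) (by omega)
    (b := fun j => b (k.succAbove j)) fun j => hb _
  have hes : Measurable fun z : (Fin n → Fin N → ℂ) × (Fin N → ℂ) => e.symm z.swap :=
    hmp.symm.measurable.comp measurable_swap
  rw [hμ] at hli
  have hli2 := Measure.ae_ae_of_ae_prod (ae_of_ae_map hes.aemeasurable hli)
  have := Measure.isProbabilityMeasure_map
    (μ := Measure.pi fun _ : Fin (N - n) => complexGaussian 1)
    (measurable_weighted_sum fun _ => b k).aemeasurable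
  rw [hμ, Measure.map_map hf hes]
  refine map_eq_of_ae_map_eq (hf.comp hes) ?_
  filter_upwards [hli2, hli'] with v hv hv'
  obtain ⟨M, hM1, hM0, hM⟩ := exists_complement_coisometry hv'
  have hlaw := complexGaussianVec_map_mulVec (hb k).le (hb k).le M (by rw [hM1])
  rw [← pi_complexGaussian_map_sqrt_mul fun _ => (hb k).le, ← complexGaussianVec, ← hlaw,
    Measure.map_map (by fun_prop) (Continuous.measurable (by fun_prop))]
  refine Measure.map_congr ?_
  filter_upwards [hv] with y hy
  have hins : e.symm (Prod.swap (v, y)) = k.insertNth y v := by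
    rw [MeasurableEquiv.symm_apply_eq]
    simp [he, MeasurableEquiv.piFinSuccAbove, Fin.insertNthEquiv]
  have hgk : e.symm (Prod.swap (v, y)) k = y := by
    rw [hins, Fin.insertNth_apply_same]
  have hgs : ∀ j, e.symm (Prod.swap (v, y)) (k.succAbove j) = v j := by
    intro j
    rw [hins, Fin.insertNth_apply_succAbove]
  have h := rowNormSq_leftInv_mul hy k (M := M) (fun j => by rw [hgs, hM0])
    (fun z hz => hM z fun j => by rw [← hgs]; exact hz j)
  rw [hgk] at h
  exact inv_eq_of_mul_eq_one_right h

theorem measurable_dotProduct {N : ℕ} (r : Fin N → ℂ) :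
    Measurable fun z : Fin N → ℂ => r ⬝ᵥ z := by
  unfold dotProduct
  fun_prop

/-- The law of the normalised noise term for a fixed nonzero detector `r`. -/
theorem map_sum_dotProduct {ι : Type*} [Fintype ι] {N : ℕ} {v : ι → ℝ} (hv : ∀ i, 0 ≤ v i)
    (r : Fin N → ℂ) (hr : 0 < ∑ j, ‖r j‖ ^ 2) :
    (Measure.pi fun i => complexGaussianVec N (v i)).map
        (fun e => (∑ j, ‖r j‖ ^ 2)⁻¹ * ∑ i, ‖r ⬝ᵥ e i‖ ^ 2)
      = (Measure.pi fun _ : ι => complexGaussian 1).map fun w => ∑ i, v i * ‖w i‖ ^ 2 := by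
  set ρ := ∑ j, ‖r j‖ ^ 2 with hρ
  set s : Fin N → ℂ := ((Real.sqrt ρ)⁻¹ : ℝ) • r with hs
  have hs1 : ∑ j, ‖s j‖ ^ 2 = 1 := by
    simp only [hs, Pi.smul_apply, norm_smul, mul_pow, ← Finset.mul_sum, norm_inv, Real.norm_eq_abs,
      inv_pow, sq_abs, Real.sq_sqrt hr.le, ← hρ]
    exact inv_mul_cancel₀ hr.ne'
  have h := Measure.pi_map_pi (μ := fun i : ι => complexGaussianVec N (v i))
    (f := fun _ z => s ⬝ᵥ z) fun i => (measurable_dotProduct s).aemeasurable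
  simp only [fun i => complexGaussianVec_map_dotProduct (hv i) (hv i) s (by rw [hs1, mul_one])]
    at h
  have hsm : Measurable fun (e : ι → Fin N → ℂ) i => s ⬝ᵥ e i := measurable_pi_lambda _ fun i =>
    (measurable_dotProduct s).comp (measurable_pi_apply i)
  rw [← pi_complexGaussian_map_sqrt_mul hv, ← h, Measure.map_map (by fun_prop) hsm]
  congr 1
  funext e
  simp only [Function.comp]
  rw [Finset.mul_sum]
  refine Finset.sum_congr rfl fun i _ => ?_
  rw [hs, smul_dotProduct, norm_smul, mul_pow, norm_inv, Real.norm_eq_abs, inv_pow, sq_abs,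
    Real.sq_sqrt hr.le]

/-- The reference law: independent standard complex Gaussian variables. -/
def refMeasure (q L K : ℕ) : Measure ((Fin q → ℂ) × (Fin L × Fin K → ℂ)) :=
  (Measure.pi fun _ => complexGaussian 1).prod (Measure.pi fun _ => complexGaussian 1)

instance (q L K : ℕ) : IsProbabilityMeasure (refMeasure q L K) := by
  unfold refMeasure
  infer_instance

/-- The signal and noise terms as functions of standard complex Gaussian variables. -/
def signalNoise {q L K : ℕ} (b : ℝ) (v : Fin L × Fin K → ℝ)
    (z : (Fin q → ℂ) × (Fin L × Fin K → ℂ)) : ℝ × ℝ :=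
  (∑ i, b * ‖z.1 i‖ ^ 2, ∑ i, v i * ‖z.2 i‖ ^ 2)

theorem measurable_signalNoise {q L K : ℕ} (b : ℝ) (v : Fin L × Fin K → ℝ) :
    Measurable (signalNoise (q := q) b v) := by
  unfold signalNoise
  fun_prop

theorem refMeasure_map_signalNoise {q L K : ℕ} (b : ℝ) (v : Fin L × Fin K → ℝ) :
    (refMeasure q L K).map (signalNoise b v)
      = ((Measure.pi fun _ : Fin q => complexGaussian 1).map fun u => ∑ i, b * ‖u i‖ ^ 2).prod
        ((Measure.pi fun _ : Fin L × Fin K => complexGaussian 1).map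
          fun w => ∑ i, v i * ‖w i‖ ^ 2) := by
  rw [Measure.map_prod_map _ _ (measurable_weighted_sum _) (measurable_weighted_sum _)]
  rfl

/-- The pair of normalised signal and noise terms after zero-forcing. -/
def zfPair {N L K : ℕ} (k : Fin K)
    (z : (Fin K → Fin N → ℂ) × (Fin L × Fin K → Fin N → ℂ)) : ℝ × ℝ :=
  ((rowNormSq (leftInv (colMat z.1)) k)⁻¹,
    (rowNormSq (leftInv (colMat z.1)) k)⁻¹ * ∑ i, ‖leftInv (colMat z.1) k ⬝ᵥ z.2 i‖ ^ 2)

theorem measurable_zfPair_snd {N L K : ℕ} (k : Fin K) :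
    Measurable fun z : (Fin K → Fin N → ℂ) × (Fin L × Fin K → Fin N → ℂ) => (zfPair k z).2 := by
  unfold zfPair
  refine (((measurable_rowNormSq_leftInv k).comp measurable_fst).inv).mul ?_
  refine Finset.measurable_fun_sum _ fun i _ => (Measurable.norm ?_).pow_const 2
  unfold dotProduct
  refine Finset.measurable_fun_sum _ fun j _ => ?_
  exact ((measurable_leftInv k j).comp measurable_fst).mul (by fun_prop)

theorem measurable_zfPair {N L K : ℕ} (k : Fin K) :
    Measurable (zfPair (N := N) (L := L) k) :=
  (((measurable_rowNormSq_leftInv k).comp measurable_fst).inv).prodMk (measurable_zfPair_snd k)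

/-- Conditionally on the channel estimate the noise term has a law free of that estimate, so the
joint law is a product. -/
theorem map_zfPair {N L K : ℕ} (hKN : K ≤ N) {b : Fin K → ℝ} (hb : ∀ j, 0 < b j)
    {v : Fin L × Fin K → ℝ} (hv : ∀ i, 0 ≤ v i) (k : Fin K) :
    ((Measure.pi fun j => complexGaussianVec N (b j)).prod
        (Measure.pi fun i => complexGaussianVec N (v i))).map (zfPair k)
      = (refMeasure (N - K + 1) L K).map (signalNoise (b k) v) := by
  -- There is a user $k$, so $K=n+1$, and $N-K+1=N-n$ is the dimension left by the other $n$
  -- columns.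
  obtain _ | n := K
  · exact k.elim0
  have hX := map_inv_rowNormSq_leftInv (q := N - (n + 1) + 1) hKN (by omega) hb k
  rw [refMeasure_map_signalNoise, ← hX]
  have := Measure.isProbabilityMeasure_map
    (μ := Measure.pi fun _ : Fin L × Fin (n + 1) => complexGaussian 1)
    (measurable_weighted_sum v).aemeasurable
  refine map_prod_of_ae_map_eq (h := fun g => (rowNormSq (leftInv (colMat g)) k)⁻¹)
    (measurable_rowNormSq_leftInv k).inv (measurable_zfPair_snd k) ?_
  filter_upwards [ae_linearIndependent hKN hb] with g hg
  exact map_sum_dotProduct hv (leftInv (colMat g) k) (rowNormSq_leftInv_pos hg k)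

/-! ### Variances -/

section Variances

variable {L K : ℕ} {β : Fin L → Fin L → Fin K → ℝ}

theorem le_sum_beta (hβ : ∀ l i k, 0 < β l i k) (l i : Fin L) (k : Fin K) :
    β l i k ≤ ∑ j, β l j k :=
  Finset.single_le_sum (f := fun j => β l j k) (fun j _ => (hβ l j k).le) (Finset.mem_univ i)

theorem sum_beta_pos (hβ : ∀ l i k, 0 < β l i k) (l : Fin L) (k : Fin K) :
    0 < ∑ j, β l j k :=
  (hβ l l k).trans_le (le_sum_beta hβ l l k)

theorem betaHat_pos (hβ : ∀ l i k, 0 < β l i k) {ν : ℝ} (hν : 0 ≤ ν) (l i : Fin L) (k : Fin K) :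
    0 < betaHat β ν l i k :=
  div_pos (pow_pos (hβ l i k) 2) (add_pos_of_pos_of_nonneg (sum_beta_pos hβ l k) hν)

theorem betaHat_le (hβ : ∀ l i k, 0 < β l i k) {ν : ℝ} (hν : 0 ≤ ν) (l i : Fin L) (k : Fin K) :
    betaHat β ν l i k ≤ betaHat β 0 l i k :=
  div_le_div_of_nonneg_left (by positivity)
    (by rw [add_zero]; exact sum_beta_pos hβ l k) (by linarith)

theorem errVar_le (hβ : ∀ l i k, 0 < β l i k) (α : ℝ) {ν : ℝ} (hν : 0 ≤ ν) (l i : Fin L)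
    (k : Fin K) : errVar β α 0 l i k ≤ errVar β α ν l i k :=
  sub_le_sub_left (mul_le_mul_of_nonneg_left (betaHat_le hβ hν l i k) (sq_nonneg α)) _

/-- With $S=\sum_m\beta_{lmj}$ the variance equals $\beta(S-\alpha^2\beta)/S$. It is positive
because either another cell makes $S>\beta$, or $\alpha^2<1$. -/
theorem errVar_zero_pos (hβ : ∀ l i k, 0 < β l i k) {α : ℝ} (hα : |α| ≤ 1)
    (hne : 2 ≤ L ∨ |α| < 1) (l i : Fin L) (k : Fin K) : 0 < errVar β α 0 l i k := by
  have hS := sum_beta_pos hβ l k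
  have hb := hβ l i k
  have hle := le_sum_beta hβ l i k
  have hα2 : α ^ 2 ≤ 1 := (sq_le_one_iff_abs_le_one α).2 hα
  have key : α ^ 2 * β l i k < ∑ j, β l j k := by
    rcases hne with hL | hlt
    · have : Nontrivial (Fin L) := Fin.nontrivial_iff_two_le.2 hL
      obtain ⟨i', hi'⟩ := exists_ne i
      have : β l i k + β l i' k ≤ ∑ j, β l j k := by
        rw [← Finset.sum_pair hi'.symm (f := fun j => β l j k)]
        exact Finset.sum_le_sum_of_subset_of_nonneg (Finset.subset_univ _)
          fun j _ _ => (hβ l j k).le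
      have := hβ l i' k
      nlinarith
    · have : α ^ 2 < 1 := (sq_lt_one_iff_abs_lt_one α).2 hlt
      nlinarith
  have : errVar β α 0 l i k
      = β l i k * ((∑ j, β l j k) - α ^ 2 * β l i k) / ∑ j, β l j k := by
    rw [errVar, betaHat, add_zero]
    field_simp
  rw [this]
  exact div_pos (mul_pos hb (by linarith)) hS

theorem tendsto_betaHat (hβ : ∀ l i k, 0 < β l i k) {ι : Type*} {f : Filter ι} {ν : ι → ℝ}
    (hν : Tendsto ν f (𝓝 0)) (l i : Fin L) (k : Fin K) :
    Tendsto (fun p => betaHat β (ν p) l i k) f (𝓝 (betaHat β 0 l i k)) :=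
  tendsto_const_nhds.div (tendsto_const_nhds.add hν)
    (by rw [add_zero]; exact (sum_beta_pos hβ l k).ne')

theorem tendsto_errVar (hβ : ∀ l i k, 0 < β l i k) (α : ℝ) {ι : Type*} {f : Filter ι} {ν : ι → ℝ}
    (hν : Tendsto ν f (𝓝 0)) (l i : Fin L) (k : Fin K) :
    Tendsto (fun p => errVar β α (ν p) l i k) f (𝓝 (errVar β α 0 l i k)) :=
  tendsto_const_nhds.sub ((tendsto_betaHat hβ hν l i k).const_mul _)

end Variances

/-! ### The law of the SINR -/

section Sinr

variable {L N K : ℕ} {β : Fin L → Fin L → Fin K → ℝ}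

/-- The SINR as a function of the signal term, the noise term and the inverse power. -/
def sinrFun (α C η : ℝ) (z : ℝ × ℝ) : ℝ := α ^ 2 * z.1 / (α ^ 2 * C * z.1 + z.2 + η)

theorem measurable_sinrFun (α C η : ℝ) : Measurable (sinrFun α C η) := by
  unfold sinrFun
  fun_prop

theorem sinr_eq_sinrFun {α p : ℝ} (hp : 0 < p) (l : Fin L) (k : Fin K)
    {Ghat Etil : Fin L → Matrix (Fin N) (Fin K) ℂ}
    (hpilot : ∀ i, Ghat i = Ghat l * Matrix.diagonal fun k => ((β l i k / β l l k : ℝ) : ℂ))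
    (hli : LinearIndependent ℂ fun j => (Ghat l).col j) :
    sinr α p l k Ghat Etil = sinrFun α (interfConst β l k) (1 / p)
      (zfPair k ((fun j => (Ghat l).col j), fun ik : Fin L × Fin K => (Etil ik.1).col ik.2)) := by
  have hcol : Ghat l = colMat fun j => (Ghat l).col j := rfl
  have hpinv : pinv (Ghat l) = leftInv (Ghat l) := by
    rw [hcol]
    exact pinv_eq_leftInv hli
  have hone : leftInv (Ghat l) * Ghat l = 1 := by
    rw [hcol]
    exact leftInv_mul hli
  have hρ : 0 < rowNormSq (leftInv (Ghat l)) k := by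
    rw [hcol]
    exact rowNormSq_leftInv_pos hli k
  have hint : ∑ i ∈ Finset.univ.erase l, rowNormSq (pinv (Ghat l) * Ghat i) k
      = interfConst β l k := by
    refine Finset.sum_congr rfl fun i _ => ?_
    rw [hpinv, hpilot i, ← Matrix.mul_assoc, hone, Matrix.one_mul, rowNormSq,
      Finset.sum_eq_single k]
    · rw [Matrix.diagonal_apply_eq, Complex.norm_real, Real.norm_eq_abs, sq_abs]
    · intro j _ hj
      rw [Matrix.diagonal_apply_ne _ hj.symm]
      simp
    · simp
  have hnoise : ∑ i, rowNormSq (pinv (Ghat l) * Etil i) k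
      = ∑ ik : Fin L × Fin K, ‖leftInv (Ghat l) k ⬝ᵥ (Etil ik.1).col ik.2‖ ^ 2 := by
    rw [Fintype.sum_prod_type, hpinv]
    rfl
  have hS : 0 ≤ ∑ ik : Fin L × Fin K, ‖leftInv (Ghat l) k ⬝ᵥ (Etil ik.1).col ik.2‖ ^ 2 :=
    Finset.sum_nonneg fun _ _ => by positivity
  have hC : 0 ≤ interfConst β l k := Finset.sum_nonneg fun _ _ => by positivity
  rw [sinr, hint, hnoise, hpinv, sinrFun, zfPair]
  simp only [← hcol]
  set ρ := rowNormSq (leftInv (Ghat l)) k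
  set S := ∑ ik : Fin L × Fin K, ‖leftInv (Ghat l) k ⬝ᵥ (Etil ik.1).col ik.2‖ ^ 2
  set C := interfConst β l k
  -- The normalised denominator is the SINR denominator divided by $p\rho$.
  have hden : α ^ 2 * C * ρ⁻¹ + ρ⁻¹ * S + 1 / p = (α ^ 2 * p * C + p * S + ρ) / (p * ρ) := by
    field_simp
  have h1 : 0 < α ^ 2 * p * C + p * S + ρ := by positivity
  rw [hden]
  field_simp

theorem IsChannelModel.hasLaw_columns {α ν : ℝ} {l : Fin L} {Ω : Type*} [MeasurableSpace Ω]
    {P : Measure Ω} [IsProbabilityMeasure P] {Ghat Etil : Fin L → Ω → Matrix (Fin N) (Fin K) ℂ}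
    (h : IsChannelModel β α ν l P Ghat Etil) :
    HasLaw (fun ω => ((fun j => (Ghat l ω).col j),
        fun ik : Fin L × Fin K => (Etil ik.1 ω).col ik.2))
      ((Measure.pi fun j => complexGaussianVec N (betaHat β ν l l j)).prod
        (Measure.pi fun ik : Fin L × Fin K =>
          complexGaussianVec N (errVar β α ν l ik.1 ik.2))) P := by
  have hm1 : ∀ j, AEMeasurable (fun ω => (Ghat l ω).col j) P := fun j =>
    (h.estimate_law j).aemeasurable
  have hm2 : ∀ ik : Fin L × Fin K, AEMeasurable (fun ω => (Etil ik.1 ω).col ik.2) P := fun ik =>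
    (h.error_law ik.1 ik.2).aemeasurable
  have hi1 : iIndepFun (fun (j : Fin K) ω => (Ghat l ω).col j) P :=
    h.indep.precomp Sum.inl_injective
  have hi2 : iIndepFun (fun (ik : Fin L × Fin K) ω => (Etil ik.1 ω).col ik.2) P :=
    h.indep.precomp Sum.inr_injective
  have hl1 := (iIndepFun_iff_map_fun_eq_pi_map hm1).1 hi1
  have hl2 := (iIndepFun_iff_map_fun_eq_pi_map hm2).1 hi2
  -- Estimates and errors occupy disjoint blocks of one independent family, so the two blocks are
  -- independent.
  have hind : IndepFun (fun ω j => (Ghat l ω).col j)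
      (fun ω (ik : Fin L × Fin K) => (Etil ik.1 ω).col ik.2) P := by
    let S : Finset (Fin K ⊕ Fin L × Fin K) := Finset.univ.map Function.Embedding.inl
    let T : Finset (Fin K ⊕ Fin L × Fin K) := Finset.univ.map Function.Embedding.inr
    have hdisj : Disjoint S T := by
      rw [Finset.disjoint_left]
      simp [S, T]
    have hm : ∀ s, AEMeasurable ((Sum.elim (fun (k : Fin K) (ω : Ω) => (Ghat l ω).col k)
        (fun (ik : Fin L × Fin K) (ω : Ω) => (Etil ik.1 ω).col ik.2)) s) P := by
      rintro (j | ik)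
      · exact hm1 j
      · exact hm2 ik
    have h0 := h.indep.indepFun_finset₀ S T hdisj hm
    exact h0.comp
      (φ := fun (x : S → Fin N → ℂ) (j : Fin K) => x ⟨Sum.inl j, by simp [S]⟩)
      (ψ := fun (x : T → Fin N → ℂ) (ik : Fin L × Fin K) => x ⟨Sum.inr ik, by simp [T]⟩)
      (by fun_prop) (by fun_prop)
  have hma : AEMeasurable (fun ω j => (Ghat l ω).col j) P := aemeasurable_pi_lambda _ hm1
  have hmb : AEMeasurable (fun ω (ik : Fin L × Fin K) => (Etil ik.1 ω).col ik.2) P :=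
    aemeasurable_pi_lambda _ hm2
  refine ⟨hma.prodMk hmb, ?_⟩
  rw [(indepFun_iff_map_prod_eq_prod_map_map hma hmb).1 hind, hl1, hl2]
  simp only [(h.estimate_law _).map_eq, (h.error_law _ _).map_eq]

/-- The law of the SINR in terms of standard complex Gaussian variables. -/
theorem IsChannelModel.hasLaw_sinr (hKN : K ≤ N) (hβ : ∀ l i k, 0 < β l i k) {α ν p : ℝ}
    (hν : 0 ≤ ν) (hp : 0 < p) {l : Fin L} {Ω : Type*} [MeasurableSpace Ω]
    {P : Measure Ω} [IsProbabilityMeasure P] {Ghat Etil : Fin L → Ω → Matrix (Fin N) (Fin K) ℂ}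
    (h : IsChannelModel β α ν l P Ghat Etil) (hα : ∀ i j, 0 ≤ errVar β α ν l i j) (k : Fin K) :
    HasLaw (fun ω => sinr α p l k (fun i => Ghat i ω) (fun i => Etil i ω))
      ((refMeasure (N - K + 1) L K).map fun z => sinrFun α (interfConst β l k) (1 / p)
        (signalNoise (betaHat β ν l l k)
          (fun ik : Fin L × Fin K => errVar β α ν l ik.1 ik.2) z)) P := by
  have hcol := h.hasLaw_columns
  have hb : ∀ j, 0 < betaHat β ν l l j := fun j => betaHat_pos hβ hν l l j
  have hli := ae_linearIndependent hKN hb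
  have hli2 : ∀ᵐ ω ∂P, LinearIndependent ℂ fun j => (Ghat l ω).col j := by
    have h1 := (Measure.quasiMeasurePreserving_fst
      (μ := Measure.pi fun j => complexGaussianVec N (betaHat β ν l l j))
      (ν := Measure.pi fun ik : Fin L × Fin K =>
        complexGaussianVec N (errVar β α ν l ik.1 ik.2))).ae hli
    rw [← hcol.map_eq] at h1
    exact ae_of_ae_map hcol.aemeasurable h1
  have hz : HasLaw (zfPair k) ((refMeasure (N - K + 1) L K).map (signalNoise (betaHat β ν l l k)
      (fun ik : Fin L × Fin K => errVar β α ν l ik.1 ik.2)))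
      ((Measure.pi fun j => complexGaussianVec N (betaHat β ν l l j)).prod
        (Measure.pi fun ik : Fin L × Fin K =>
          complexGaussianVec N (errVar β α ν l ik.1 ik.2))) :=
    ⟨(measurable_zfPair k).aemeasurable, map_zfPair hKN hb (fun ik => hα ik.1 ik.2) k⟩
  have hs : HasLaw (sinrFun α (interfConst β l k) (1 / p))
      ((refMeasure (N - K + 1) L K).map fun z => sinrFun α (interfConst β l k) (1 / p)
        (signalNoise (betaHat β ν l l k)
          (fun ik : Fin L × Fin K => errVar β α ν l ik.1 ik.2) z))
      ((refMeasure (N - K + 1) L K).map (signalNoise (betaHat β ν l l k)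
      (fun ik : Fin L × Fin K => errVar β α ν l ik.1 ik.2))) :=
    ⟨(measurable_sinrFun _ _ _).aemeasurable,
      Measure.map_map (measurable_sinrFun _ _ _) (measurable_signalNoise _ _)⟩
  refine ((hs.comp hz).comp hcol).congr ?_
  filter_upwards [hli2] with ω hω
  exact sinr_eq_sinrFun hp l k (fun i => h.pilot_reuse i ω) hω

end Sinr

/-! ### Tightness and positivity of the noise term -/

/-- A finite real random variable is bounded in probability. -/
theorem exists_measure_gt_le {Ω : Type*} [MeasurableSpace Ω] (μ : Measure Ω)
    [IsProbabilityMeasure μ] {R : Ω → ℝ} (hR : Measurable R) {ε : ℝ} (hε : 0 < ε) :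
    ∃ M : ℝ, μ {ω | M < R ω} ≤ ENNReal.ofReal ε := by
  have := Measure.isProbabilityMeasure_map (μ := μ) hR.aemeasurable
  have h1 := (tendsto_order.1 (tendsto_cdf_atTop (μ.map R))).1 (1 - ε) (by linarith)
  obtain ⟨M, hM⟩ := h1.exists
  refine ⟨M, ?_⟩
  have h2 : μ {ω | M < R ω} = μ.map R (Set.Iic M)ᶜ := by
    rw [Measure.map_apply hR measurableSet_Iic.compl]
    congr 1
    ext ω
    simp
  rw [h2, ← ofReal_measureReal, measureReal_compl measurableSet_Iic, ← cdf_eq_real]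
  refine ENNReal.ofReal_le_ofReal ?_
  rw [probReal_univ]
  linarith

/-- One nonzero Gaussian coordinate with positive weight suffices, which is why the index set must
be nonempty. -/
theorem ae_noise_pos {q L K : ℕ} (b : ℝ) {v : Fin L × Fin K → ℝ} (hv : ∀ i, 0 < v i)
    [Nonempty (Fin L × Fin K)] :
    ∀ᵐ z ∂refMeasure q L K, 0 < (signalNoise b v z).2 := by
  have h := (Measure.quasiMeasurePreserving_snd
    (μ := Measure.pi fun _ : Fin q => complexGaussian 1)).ae
    (ae_ne_zero_pi_complexGaussian (ι := Fin L × Fin K) one_pos)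
  filter_upwards [h] with z hz
  obtain ⟨i, hi⟩ := hz
  refine Finset.sum_pos' (fun j _ => mul_nonneg (hv j).le (by positivity))
    ⟨i, Finset.mem_univ i, mul_pos (hv i) (by positivity)⟩

end UplinkZF

end

/-! ### The high-power limit and the uniform ceiling -/

open UplinkZF in
theorem corollary1 {L N K τ : ℕ} (hKN : K ≤ N) (hKτ : K ≤ τ)
    (β : Fin L → Fin L → Fin K → ℝ) (hβ : ∀ l i k, 0 < β l i k)
    (α : ℝ) (hα : |α| ≤ 1) (hne : 2 ≤ L ∨ |α| < 1) (l : Fin L) (k : Fin K)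
    {Ω : Set.Ioi (0 : ℝ) → Type*} [∀ p, MeasurableSpace (Ω p)]
    (P : (p : Set.Ioi (0 : ℝ)) → Measure (Ω p)) [∀ p, IsProbabilityMeasure (P p)]
    (Ghat Etil : (p : Set.Ioi (0 : ℝ)) → Fin L → Ω p → Matrix (Fin N) (Fin K) ℂ)
    (hmodel : ∀ p : Set.Ioi (0 : ℝ), IsChannelModel β α (1 / (τ * (p : ℝ))) l (P p) (Ghat p) (Etil p))
    {Ω' : Type*} [MeasurableSpace Ω'] (P' : Measure Ω') [IsProbabilityMeasure P']
    (X Y : Ω' → ℝ)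
    (hX : HasLaw X (volume.withDensity fun x =>
      ENNReal.ofReal (pdfX N K (betaHat β 0 l l k) x)) P')
    (hY : HasLaw Y (volume.withDensity fun y =>
      ENNReal.ofReal (pdfY (fun ik : Fin L × Fin K => errVar β α 0 l ik.1 ik.2) y)) P')
    (hXY : IndepFun X Y P') :
    TendstoInDistribution
      (fun (p : Set.Ioi (0 : ℝ)) (ω : Ω p) =>
        sinr α (p : ℝ) l k (fun i => Ghat p i ω) (fun i => Etil p i ω))
      atTop
      (fun ω => α ^ 2 * X ω / (α ^ 2 * interfConst β l k * X ω + Y ω)) P P' ∧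
    (∀ᵐ ω ∂P', 0 < α ^ 2 * interfConst β l k * X ω + Y ω) ∧
    (∀ ε : ℝ, 0 < ε → ∃ M : ℝ, ∀ p : Set.Ioi (0 : ℝ),
      P p {ω | M < sinr α (p : ℝ) l k (fun i => Ghat p i ω) (fun i => Etil p i ω)}
        ≤ ENNReal.ofReal ε) := by
  have : Nonempty (Fin L × Fin K) := ⟨(l, k)⟩
  set C := interfConst β l k with hCdef
  have hC : 0 ≤ C := Finset.sum_nonneg fun _ _ => by positivity
  have hτ : (0 : ℝ) < τ := by
    have := k.pos
    exact_mod_cast (by omega : 0 < τ)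
  set ν : Set.Ioi (0 : ℝ) → ℝ := fun p => 1 / (τ * (p : ℝ)) with hν
  have hν0 : ∀ p, 0 ≤ ν p := fun p => by
    have : (0 : ℝ) < p := p.2
    positivity
  set b : ℝ → ℝ := fun ν => betaHat β ν l l k with hb
  set v : ℝ → Fin L × Fin K → ℝ := fun ν ik => errVar β α ν l ik.1 ik.2 with hv
  have hv0 : ∀ ik, 0 < v 0 ik := fun ik => errVar_zero_pos hβ hα hne l ik.1 ik.2
  have hvle : ∀ p ik, v 0 ik ≤ v (ν p) ik := fun p ik => errVar_le hβ α (hν0 p) l ik.1 ik.2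
  have hb0 : 0 < b 0 := betaHat_pos hβ le_rfl l l k
  have hbp : ∀ p, 0 < b (ν p) := fun p => betaHat_pos hβ (hν0 p) l l k
  have hble : ∀ p, b (ν p) ≤ b 0 := fun p => betaHat_le hβ (hν0 p) l l k
  set μ₀ := refMeasure (N - K + 1) L K with hμ₀
  -- Coupling: every $\gamma_k$ has the law of some `F p` on the same Gaussian space, and $p$
  -- affects only the function.
  set F : Set.Ioi (0 : ℝ) → (Fin (N - K + 1) → ℂ) × (Fin L × Fin K → ℂ) → ℝ :=
    fun p z => sinrFun α C (1 / (p : ℝ)) (signalNoise (b (ν p)) (v (ν p)) z) with hF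
  set F₀ : (Fin (N - K + 1) → ℂ) × (Fin L × Fin K → ℂ) → ℝ :=
    fun z => sinrFun α C 0 (signalNoise (b 0) (v 0) z) with hF₀
  have hlaw : ∀ p : Set.Ioi (0 : ℝ), HasLaw (fun ω : Ω p =>
      sinr α (p : ℝ) l k (fun i => Ghat p i ω) (fun i => Etil p i ω)) (μ₀.map (F p)) (P p) :=
    fun p => (hmodel p).hasLaw_sinr hKN hβ (hν0 p) p.2
      (fun i j => ((hv0 (i, j)).trans_le (hvle p (i, j))).le) k
  have hFm : ∀ p, Measurable (F p) := fun p =>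
    (measurable_sinrFun _ _ _).comp (measurable_signalNoise _ _)
  have hF₀m : Measurable F₀ := (measurable_sinrFun _ _ _).comp (measurable_signalNoise _ _)
  have hXYlaw : HasLaw (fun ω => (X ω, Y ω)) (μ₀.map (signalNoise (b 0) (v 0))) P' := by
    refine ⟨hX.aemeasurable.prodMk hY.aemeasurable, ?_⟩
    rw [(indepFun_iff_map_prod_eq_prod_map_map hX.aemeasurable hY.aemeasurable).1 hXY, hX.map_eq,
      hY.map_eq, withDensity_pdfX N K hb0, withDensity_pdfY hv0, refMeasure_map_signalNoise]
  have hlim : HasLaw (fun ω => α ^ 2 * X ω / (α ^ 2 * C * X ω + Y ω)) (μ₀.map F₀) P' := by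
    have h1 : HasLaw (sinrFun α C 0) (μ₀.map F₀) (μ₀.map (signalNoise (b 0) (v 0))) :=
      ⟨(measurable_sinrFun _ _ _).aemeasurable,
        Measure.map_map (measurable_sinrFun _ _ _) (measurable_signalNoise _ _)⟩
    refine (h1.comp hXYlaw).congr (ae_of_all _ fun ω => ?_)
    simp [sinrFun]
  have hpos : ∀ᵐ z ∂μ₀, 0 < (signalNoise (b 0) (v 0) z).2 := ae_noise_pos (b 0) hv0
  -- The signal component ignores the error variances, so this also serves, by unfolding, for `v (ν
  -- p)`.
  have hsig : ∀ c, 0 ≤ c → ∀ z : (Fin (N - K + 1) → ℂ) × (Fin L × Fin K → ℂ),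
      0 ≤ (signalNoise c (v 0) z).1 := fun c hc z =>
    show 0 ≤ ∑ i, c * ‖z.1 i‖ ^ 2 from
      Finset.sum_nonneg fun _ _ => mul_nonneg hc (by positivity)
  refine ⟨?_, ?_, ?_⟩
  · have hcoe : Tendsto (fun p : Set.Ioi (0 : ℝ) => (p : ℝ)) atTop atTop :=
      tendsto_comp_val_Ioi_atTop.2 tendsto_id
    have hp0 : Tendsto (fun p : Set.Ioi (0 : ℝ) => 1 / (p : ℝ)) atTop (𝓝 0) :=
      tendsto_const_nhds.div_atTop hcoe
    have hνt : Tendsto ν atTop (𝓝 0) :=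
      tendsto_const_nhds.div_atTop (hcoe.const_mul_atTop hτ)
    have hcg : (atTop : Filter (Set.Ioi (0 : ℝ))).IsCountablyGenerated := by
      rw [atTop_Ioi_eq]
      infer_instance
    have hT : TendstoInDistribution F atTop F₀ (fun _ => μ₀) μ₀ := by
      refine tendstoInDistribution_of_ae_tendsto (fun p => (hFm p).aemeasurable)
        hF₀m.aemeasurable ?_
      filter_upwards [hpos] with z hz
      have h1 : Tendsto (fun p => (signalNoise (b (ν p)) (v (ν p)) z).1) atTop
          (𝓝 (signalNoise (b 0) (v 0) z).1) :=
        tendsto_finsetSum Finset.univ fun i _ =>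
          (tendsto_betaHat hβ hνt l l k).mul_const (‖z.1 i‖ ^ 2)
      have h2 : Tendsto (fun p => (signalNoise (b (ν p)) (v (ν p)) z).2) atTop
          (𝓝 (signalNoise (b 0) (v 0) z).2) :=
        tendsto_finsetSum Finset.univ fun i _ =>
          (tendsto_errVar hβ α hνt l i.1 i.2).mul_const (‖z.2 i‖ ^ 2)
      refine (h1.const_mul _).div (((h1.const_mul _).add h2).add hp0) ?_
      have := hsig (b 0) hb0.le z
      positivity
    refine ⟨fun p => (hlaw p).aemeasurable, hlim.aemeasurable, ?_⟩
    -- Convergence in distribution involves only laws, so it transfers from `F` to the SINRs living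
    -- on unrelated spaces.
    have e1 : ∀ p, (⟨(P p).map _, Measure.isProbabilityMeasure_map (hlaw p).aemeasurable⟩ :
        ProbabilityMeasure ℝ) = ⟨μ₀.map (F p), Measure.isProbabilityMeasure_map
          (hFm p).aemeasurable⟩ := fun p => Subtype.ext (hlaw p).map_eq
    have e2 : (⟨P'.map _, Measure.isProbabilityMeasure_map hlim.aemeasurable⟩ :
        ProbabilityMeasure ℝ) = ⟨μ₀.map F₀, Measure.isProbabilityMeasure_map
          hF₀m.aemeasurable⟩ := Subtype.ext hlim.map_eq
    rw [e2]
    exact (tendsto_congr e1).2 hT.tendsto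
  · refine (hXYlaw.ae_iff (p := fun z => 0 < α ^ 2 * C * z.1 + z.2)
      (measurableSet_setOfPred.1 (measurableSet_lt measurable_const (by fun_prop)))).2 ?_
    rw [ae_map_iff (measurable_signalNoise _ _).aemeasurable
      (measurableSet_lt measurable_const (by fun_prop))]
    filter_upwards [hpos] with z hz
    have := hsig (b 0) hb0.le z
    positivity
  · intro ε hε
    -- Majorant for all $p$ at once: take the largest signal and the smallest noise, both attained
    -- in the limit $\nu=0$, and drop the nonnegative terms $\alpha^2CX_p$ and $1/p$.
    set R : (Fin (N - K + 1) → ℂ) × (Fin L × Fin K → ℂ) → ℝ := fun z =>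
      α ^ 2 * (signalNoise (b 0) (v 0) z).1 / (signalNoise (b 0) (v 0) z).2 with hR
    have hRm : Measurable R :=
      (((measurable_signalNoise _ _).fst).const_mul _).div (measurable_signalNoise _ _).snd
    obtain ⟨M, hM⟩ := exists_measure_gt_le μ₀ hRm hε
    refine ⟨M, fun p => ?_⟩
    rw [(hlaw p).measure_eq (p := fun x => M < x) measurableSet_Ioi]
    change (μ₀.map (F p)) (Set.Ioi M) ≤ _
    rw [Measure.map_apply (hFm p) (measurableSet_Ioi (a := M))]
    refine (measure_mono_ae ?_).trans hM
    filter_upwards [hpos] with z hz hzM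
    refine lt_of_lt_of_le (show M < F p z from hzM) ?_
    have hp : (0 : ℝ) < p := p.2
    have h1 : 0 ≤ (signalNoise (b (ν p)) (v (ν p)) z).1 := hsig (b (ν p)) (hbp p).le z
    have h2 : (signalNoise (b 0) (v 0) z).2 ≤ (signalNoise (b (ν p)) (v (ν p)) z).2 :=
      Finset.sum_le_sum fun i _ => mul_le_mul_of_nonneg_right (hvle p i) (by positivity)
    have h3 : (signalNoise (b (ν p)) (v (ν p)) z).1 ≤ (signalNoise (b 0) (v 0) z).1 :=
      Finset.sum_le_sum (s := Finset.univ) fun i _ =>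
        mul_le_mul_of_nonneg_right (hble p) (sq_nonneg ‖z.1 i‖)
    have h4 : 0 ≤ α ^ 2 * C * (signalNoise (b (ν p)) (v (ν p)) z).1 := by positivity
    have h5 : 0 < 1 / (p : ℝ) := by positivity
    exact div_le_div₀ (mul_nonneg (sq_nonneg _) (h1.trans h3))
      (mul_le_mul_of_nonneg_left h3 (sq_nonneg _)) hz (by linarith)
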